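/- Let $n\ge 1$, let $I$ be a non-empty smooth one-dimensional manifold without boundary (for instance an open interval or a circle), and let $\mathcal F_{n+2}$ be the manifold of complete flags $V_1\subset V_2\subset\cdots\subset V_{n+1}\subset\mathbf R^{n+2}$, $\dim V_i=i$, with the projection $\pi_1:\mathcal F_{n+2}\to P^{n+1}=\mathrm{Gr}(1,\mathbf R^{n+2})$, $\pi_1(V_1,\dots,V_{n+1})=V_1$. The pseudo-contact distribution $\mathcal D\subset T\mathcal F_{n+2}$ consists of the tangent vectors $v$ at $(V_1,\dots,V_{n+1})$ with $\pi_{1*}(v)\in T\,\mathrm{Gr}(1,V_{n+1})\subset T\,\mathrm{Gr}(1,\mathbf R^{n+2})$. Let $\boldsymbol a=(a_1,\dots,a_{n+1})$ be integers with $1\le a_1<a_2<\cdots<a_{n+1}$. A $C^\infty$ curve $\gamma$ in $\mathbf R^{n+2}\setminus\{0\}$ is of type $\boldsymbol a$ at $t_0$ if, for $1\le i\le n+1$, $a_i$ is the least $k$ for which the matrix $(\gamma(t_0),\gamma'(t_0),\dots,\gamma^{(k)}(t_0))$ has rank $i+1$; a curve in $P^{n+1}$ is of type $\boldsymbol a$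 at $t_0$ if a local $C^\infty$ lift of it to $\mathbf R^{n+2}\setminus\{0\}$ is so (in a local coordinate of $I$). Put $s(\boldsymbol a)=\sum_{i=1}^{n+1}(a_i-i)$. Let $r\ge a_{n+1}$, let $J^r_{\mathcal D}(I,\mathcal F_{n+2})\subset J^r(I,\mathcal F_{n+2})$ be the set of $r$-jets of (germs of) $C^\infty$ curves $\Gamma:I\to\mathcal F_{n+2}$ that are integral to $\mathcal D$, and let $\Sigma_{\mathcal D}(\boldsymbol a)\subset J^r_{\mathcal D}(I,\mathcal F_{n+2})$ be the set of $r$-jets at points $t_0\in I$ of $\mathcal D$-integral curves $\Gamma$ such that $\pi_1\circ\Gamma$ is of type $\boldsymbol a$ at $t_0$. Then $J^r_{\mathcal D}(I,\mathcal F_{n+2})$ and $\Sigma_{\mathcal D}(\boldsymbol a)$ are submanifolds of $J^r(I,\mathcal F_{n+2})$, $\Sigma_{\mathcal D}(\boldsymbol a)$ is non-empty, and the codimension of $\Sigma_{\mathcal D}(\boldsymbol a)$ in $J^r_{\mathcal D}(I,\mathcal F_{n+2})$ is $$\sum_{i=2}^{n+1}(a_i-i)=s(\boldsymbol a)-(a_1-1).$$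 -/

import Mathlib

open scoped Manifold ContDiff

namespace FlagJet

/-! ### Complete flags in `ℝ^{n+2}` and the standard charts of the flag manifold -/

/-- The vector space `ℝ^{n+2}`. -/
abbrev Vec (n : ℕ) : Type := Fin (n + 2) → ℝ

/-- Square matrices of size `n+2`. -/
abbrev Mat (n : ℕ) : Type := Matrix (Fin (n + 2)) (Fin (n + 2)) ℝ

/-- A point of the flag manifold `F_{n+2}`: a complete (non-oriented) flag
`V_1 ⊂ V_2 ⊂ ⋯ ⊂ V_{n+1} ⊂ ℝ^{n+2}` with `dim V_i = i`; here `V_i` is `V (i-1)`. -/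
structure CompleteFlag (n : ℕ) where
  V : Fin (n + 1) → Submodule ℝ (Vec n)
  mono : Monotone V
  finrank_eq : ∀ i, Module.finrank ℝ (V i) = (i : ℕ) + 1

/-- The line `V_1 = π_1(V_1, …, V_{n+1})`. -/
def CompleteFlag.line {n : ℕ} (F : CompleteFlag n) : Submodule ℝ (Vec n) := F.V 0

/-- The span of the first `k` columns of a matrix. -/
def colSpan {n : ℕ} (A : Mat n) (k : ℕ) : Submodule ℝ (Vec n) :=
  Submodule.span ℝ {v | ∃ j : Fin (n + 2), (j : ℕ) < k ∧ v = fun i => A i j}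

/-- The coordinates `x_i^j`, `0 ≤ j < i ≤ n+1`, on an affine cell of the flag manifold. -/
abbrev Coord (n : ℕ) : Type := {p : Fin (n + 2) × Fin (n + 2) // p.2 < p.1} → ℝ

/-- The lower triangular matrix with ones on the diagonal and entries `x_i^j` below it. -/
def lowerMat {n : ℕ} (x : Coord n) : Mat n :=
  Matrix.of fun i j => if h : j < i then x ⟨(i, j), h⟩ else if i = j then 1 else 0

/-- The flag `F` lies in the affine cell around the flag of `g ∈ GL(n+2, ℝ)` and has coordinates
`x` there: `V_i` is spanned by the first `i` columns of `g * lowerMat x`. These cells, for all `g`,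
are the charts that define the smooth structure of the flag manifold. -/
def IsChartCoord {n : ℕ} (g : GL (Fin (n + 2)) ℝ) (x : Coord n) (F : CompleteFlag n) : Prop :=
  ∀ i : Fin (n + 1), F.V i = colSpan ((g : Mat n) * lowerMat x) ((i : ℕ) + 1)

/-- In the chart given by `g`, a vector that spans the line `V_1` of the flag with coordinates `x`;
thus `x ↦ [lineVec g x]` is the expression of `π_1 : F_{n+2} → P^{n+1}`. -/
def lineVec {n : ℕ} (g : GL (Fin (n + 2)) ℝ) (x : Coord n) : Vec n :=
  fun i => ((g : Mat n) * lowerMat x) i 0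

/-- The pseudo-contact distribution `D` at the flag with coordinates `x` in the chart given by `g`,
as a subspace of the tangent space (identified with `Coord n` by the chart): those tangent vectors
whose image under `dπ_1` is tangent to `Gr(1, V_{n+1})`. Recall that the tangent space of
`Gr(1, ℝ^{n+2})` at a line `ℓ` is `Hom(ℓ, ℝ^{n+2}/ℓ)` and that of `Gr(1, V_{n+1})` is the subspace
`Hom(ℓ, V_{n+1}/ℓ)`. -/
noncomputable def pseudoContact {n : ℕ} (g : GL (Fin (n + 2)) ℝ) (x : Coord n) :
    Submodule ℝ (Coord n) :=
  (colSpan ((g : Mat n) * lowerMat x) (n + 1)).comap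
    (fderiv ℝ (lineVec g) x : Coord n →ₗ[ℝ] Vec n)

/-! ### Type of a curve -/

/-- The `(n+2) × (r+1)` matrix `(γ(t), γ'(t), …, γ^{(r)}(t))`. -/
noncomputable def derivMatrix {n : ℕ} (γ : ℝ → Vec n) (t : ℝ) (r : ℕ) :
    Matrix (Fin (n + 2)) (Fin (r + 1)) ℝ :=
  Matrix.of fun i k => iteratedDeriv (k : ℕ) γ t i

/-- The curve `γ` in `ℝ^{n+2}` is of type `(a_1, …, a_{n+1})` at `t`; here `a_i` is `a (i-1)`. -/
def IsOfType {n : ℕ} (γ : ℝ → Vec n) (t : ℝ) (a : Fin (n + 1) → ℕ) : Prop :=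
  ∀ i : Fin (n + 1), IsLeast {r : ℕ | (derivMatrix γ t r).rank = (i : ℕ) + 2} (a i)

/-! ### Curves in the flag manifold, parametrised by a one-dimensional manifold `I` -/

section Curves

variable {I : Type*} [TopologicalSpace I] [ChartedSpace ℝ I] {n : ℕ}

/-- On the open set `W` of values of the local coordinate `κ` of `I`, the curve `Γ` has the
smooth expression `u` in the chart of the flag manifold given by `g`. -/
structure IsLocalExpr (Γ : I → CompleteFlag n) (κ : OpenPartialHomeomorph I ℝ)
    (g : GL (Fin (n + 2)) ℝ) (u : ℝ → Coord n) (W : Set ℝ) : Prop where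
  mem_atlas : κ ∈ atlas ℝ I
  isOpen : IsOpen W
  subset : W ⊆ κ.target
  smooth : ContDiffOn ℝ ∞ u W
  expr : ∀ s ∈ W, IsChartCoord g (u s) (Γ (κ.symm s))

/-- `Γ` is a smooth curve near `t`. -/
def SmoothNear (Γ : I → CompleteFlag n) (t : I) : Prop :=
  ∃ κ g u W, IsLocalExpr Γ κ g u W ∧ t ∈ κ.source ∧ κ t ∈ W

/-- `Γ` is, near `t`, a smooth integral curve of the distribution `D`. -/
def IsIntegralNear (Γ : I → CompleteFlag n) (t : I) : Prop :=
  ∃ κ g u W, IsLocalExpr Γ κ g u W ∧ t ∈ κ.source ∧ κ t ∈ W ∧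
    ∀ s ∈ W, deriv u s ∈ pseudoContact g (u s)

/-- The projection `π_1 ∘ Γ`, a curve in `P^{n+1}`, is of type `a` at `t`: in a local coordinate
`κ` of `I` it has a smooth lift `γ` to `ℝ^{n+2} ∖ {0}` near `κ t` that is of type `a` there. -/
def ProjIsOfType (Γ : I → CompleteFlag n) (t : I) (a : Fin (n + 1) → ℕ) : Prop :=
  ∃ κ ∈ atlas ℝ I, t ∈ κ.source ∧ ∃ (W : Set ℝ) (γ : ℝ → Vec n),
    IsOpen W ∧ κ t ∈ W ∧ W ⊆ κ.target ∧ ContDiffOn ℝ ∞ γ W ∧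
    (∀ s ∈ W, γ s ≠ 0 ∧ (Γ (κ.symm s)).line = Submodule.span ℝ {γ s}) ∧
    IsOfType γ (κ t) a

end Curves

/-! ### The jet space `J^r(I, F_{n+2})` -/

section Jets

variable (I : Type*) [TopologicalSpace I] [ChartedSpace ℝ I] (n : ℕ)

/-- A point `t` of `I` with a curve that is smooth near `t`. -/
structure CurveAt where
  t : I
  Γ : I → CompleteFlag n
  smooth : SmoothNear Γ t

variable {I n}

/-- The space of local coordinates of the jet space: the parameter and the derivatives of orders
`0, …, r` of the coordinates of the curve. -/
abbrev JetCoord (n r : ℕ) : Type := ℝ × (Fin (r + 1) → Coord n)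

/-- In the charts `κ` of `I` and `g` of the flag manifold, the `r`-jet of the curve at its base
point has coordinates `x`. -/
def CurveAt.HasJetCoord {r : ℕ} (c : CurveAt I n) (κ : OpenPartialHomeomorph I ℝ)
    (g : GL (Fin (n + 2)) ℝ) (x : JetCoord n r) : Prop :=
  ∃ u W, IsLocalExpr c.Γ κ g u W ∧ c.t ∈ κ.source ∧ κ c.t ∈ W ∧
    x = (κ c.t, fun k : Fin (r + 1) => iteratedDeriv (k : ℕ) u (κ c.t))

variable (I n)

/-- Two curves have the same `r`-jet if they have the same base point and the same value and
derivatives up to order `r` there, in all charts. -/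
def jetSetoid (r : ℕ) : Setoid (CurveAt I n) where
  r c c' := c.t = c'.t ∧ ∀ κ g (x : JetCoord n r), c.HasJetCoord κ g x ↔ c'.HasJetCoord κ g x
  iseqv :=
    { refl := fun _ => ⟨rfl, fun _ _ _ => Iff.rfl⟩
      symm := fun h => ⟨h.1.symm, fun κ g x => (h.2 κ g x).symm⟩
      trans := fun h h' => ⟨h.1.trans h'.1, fun κ g x => (h.2 κ g x).trans (h'.2 κ g x)⟩ }

/-- The jet space `J^r(I, F_{n+2})`. -/
def JetSpace (r : ℕ) : Type _ := Quotient (jetSetoid I n r)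

variable {I n}

/-- The `r`-jet of a curve at its base point. -/
def CurveAt.jet (c : CurveAt I n) (r : ℕ) : JetSpace I n r := Quotient.mk (jetSetoid I n r) c

variable (I n)

/-- The space `J^r_D(I, F_{n+2})` of `r`-jets of `D`-integral curves. -/
def integralJets (r : ℕ) : Set (JetSpace I n r) :=
  {j | ∃ c : CurveAt I n, c.jet r = j ∧ IsIntegralNear c.Γ c.t}

/-- The set `Σ_D(a)` of `r`-jets of `D`-integral curves `Γ` such that `π_1 ∘ Γ` is of type `a`
at the base point. -/
def typeJets (r : ℕ) (a : Fin (n + 1) → ℕ) : Set (JetSpace I n r) :=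
  {j | ∃ c : CurveAt I n, c.jet r = j ∧ IsIntegralNear c.Γ c.t ∧ ProjIsOfType c.Γ c.t a}

variable {I n}

/-- The part of a set of jets that lies in the chart given by `κ` and `g`, in coordinates. -/
def chartImage {r : ℕ} (S : Set (JetSpace I n r)) (κ : OpenPartialHomeomorph I ℝ)
    (g : GL (Fin (n + 2)) ℝ) : Set (JetCoord n r) :=
  {x | ∃ c : CurveAt I n, c.jet r ∈ S ∧ c.HasJetCoord κ g x}

end Jets

/-! ### Submanifolds and codimension -/

/-- `S` is an embedded smooth submanifold of codimension `m` of (an open set of) the normed space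
`E`: locally the zero set of a smooth submersion to `ℝ^m`. -/
def IsSubmanifoldOfCodim {E : Type*} [NormedAddCommGroup E] [NormedSpace ℝ E]
    (S : Set E) (m : ℕ) : Prop :=
  ∀ x ∈ S, ∃ (U : Set E) (f : E → (Fin m → ℝ)), IsOpen U ∧ x ∈ U ∧ ContDiffOn ℝ ∞ f U ∧
    (∀ y ∈ U, Function.Surjective (fderiv ℝ f y)) ∧ S ∩ U = {y ∈ U | f y = 0}

section Codim

variable {I : Type*} [TopologicalSpace I] [ChartedSpace ℝ I] {n r : ℕ}

/-- `S` is an embedded smooth submanifold of codimension `m` of the jet space: it is so in all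
charts. -/
def IsJetSubmanifold (S : Set (JetSpace I n r)) (m : ℕ) : Prop :=
  ∀ κ ∈ atlas ℝ I, ∀ g : GL (Fin (n + 2)) ℝ, IsSubmanifoldOfCodim (chartImage S κ g) m

/-- `S` and `M` are submanifolds of the jet space, `S ⊆ M`, and `S` has codimension `c` in `M`. -/
def HasCodimIn (S M : Set (JetSpace I n r)) (c : ℤ) : Prop :=
  S ⊆ M ∧ ∃ m k : ℕ, IsJetSubmanifold M m ∧ IsJetSubmanifold S k ∧ (k : ℤ) - (m : ℤ) = c

end Codim

/-- The Schubert number `s(a) = ∑_{i=1}^{n+1} (a_i - i)`. -/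
def schubertNumber {n : ℕ} (a : Fin (n + 1) → ℕ) : ℤ :=
  ∑ i : Fin (n + 1), ((a i : ℤ) - ((i : ℕ) + 1 : ℤ))

end FlagJet

open scoped Manifold ContDiff

/-! In an affine cell, write the line as `g (1, x_1, …, x_{n+1})` and the hyperplane `V_{n+1}` as
the image under `g` of the kernel of a form `(y_0, y_1, …, y_n, 1)`. The distribution is then the
kernel of the single form `dx_{n+1} + ∑ y_j dx_j` (`mem_pseudoContact_iff`). The diffeomorphism
`straighten` turns the `y_j` into coordinates, and its prolongation is a diffeomorphism of jet
coordinates, so all counting can be done there.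

An `r`-jet comes from an integral curve exactly when the derivatives of orders `0, …, r-1` of the
contact form along it vanish: these are Leibniz sums (`contactEq_jetOf`), and conversely `x_{n+1}`
is recovered from the other coordinates by integration (`exists_integral_curve`). Equation `k` can
be solved for `x_{n+1}^{(k+1)}`, so integral jets have codimension `r`.

Type `a` means that the derivatives of `(1, x_1, …, x_{n+1})` of orders `0, a_1, …, a_{n+1}` form a
basis, in which the derivative of order `c` has coordinate zero at every basis vector of order
greater than `c`. Orders in the basis give no condition. For `1 ≤ c < a_1` the whole derivative
vanishes; the contact equations carry this from `x_1, …, x_n` to `x_{n+1}`, so `n` equations suffice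
instead of `n+1`. This saves `a_1 - 1` equations and leaves `a_i - i` of them for each `i ≥ 2`
(`card_typeEqIdx`).

These equations are independent together with the contact equations
(`surjective_fderiv_contactTypeEq`): some `x_j^{(a_1)}` with `j ≤ n` is nonzero, and varying the
`y_j` along this vector corrects the contact equations of order at least `a_1 - 1` through a
triangular system (`exists_contactLin_eq`).

Integrality and type do not depend on charts, since two lifts of a curve of lines differ by a factor
and a reparametrisation, which preserve `derivSpan`. -/

namespace FlagJet

/-! ### Submanifolds cut out by independent equations -/

section Submersions

variable {E F : Type*} [NormedAddCommGroup E] [NormedSpace ℝ E]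
  [NormedAddCommGroup F] [NormedSpace ℝ F]

theorem surjective_fderiv_of_hasDerivAt_line {f : E → F} {x : E} (hf : DifferentiableAt ℝ f x)
    (h : ∀ η : F, ∃ δ : E, HasDerivAt (fun s : ℝ => f (x + s • δ)) η 0) :
    Function.Surjective (fderiv ℝ f x) := by
  intro η
  obtain ⟨δ, hδ⟩ := h η
  refine ⟨δ, ?_⟩
  have h1 : HasLineDerivAt ℝ f (fderiv ℝ f x δ) x δ := hf.hasFDerivAt.hasLineDerivAt δ
  exact HasDerivAt.unique h1 hδ

/-- With `R` a right inverse of `A x`, the endomorphisms `A y ∘ R` are close to the identity, hence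
invertible. -/
theorem eventually_surjective [FiniteDimensional ℝ F] {X : Type*} [TopologicalSpace X]
    {A : X → E →L[ℝ] F} {x : X} (hA : ContinuousAt A x) (hx : Function.Surjective (A x)) :
    ∀ᶠ y in nhds x, Function.Surjective (A y) := by
  have := FiniteDimensional.complete ℝ F
  obtain ⟨R, hR⟩ := (A x).exists_rightInverse_of_surjective
    (LinearMap.range_eq_top.2 hx)
  have hc : ContinuousAt (fun y => (A y).comp R) x := hA.clm_comp continuousAt_const
  have hu : IsUnit ((A x).comp R) := by
    rw [hR]; exact isUnit_one
  have hev : ∀ᶠ T in nhds ((A x).comp R), IsUnit (T : F →L[ℝ] F) := Units.isOpen.mem_nhds hu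
  filter_upwards [hc.eventually hev] with y hy
  obtain ⟨T, hT⟩ := hy
  intro η
  refine ⟨R ((T⁻¹ : (F →L[ℝ] F)ˣ).1 η), ?_⟩
  change ((A y).comp R) _ = η
  rw [← hT]
  exact congrArg (fun Q : F →L[ℝ] F => Q η) T.mul_inv

/-- Surjectivity is an open condition, so checking it at the point itself is enough after shrinking
the neighbourhood. -/
theorem isSubmanifoldOfCodim_of_equations {ι : Type*} [Fintype ι] {S : Set E}
    (h : ∀ x ∈ S, ∃ (U : Set E) (f : E → ι → ℝ), IsOpen U ∧ x ∈ U ∧ ContDiff ℝ ∞ f ∧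
      Function.Surjective (fderiv ℝ f x) ∧ S ∩ U = {y ∈ U | f y = 0}) :
    IsSubmanifoldOfCodim S (Fintype.card ι) := by
  intro x hx
  obtain ⟨U, f, hU, hxU, hf, hs, hSU⟩ := h x hx
  have hcont : ContinuousAt (fderiv ℝ f) x := (hf.continuous_fderiv (by simp)).continuousAt
  obtain ⟨V, hV, hVo, hxV⟩ := eventually_nhds_iff.1 (eventually_surjective hcont hs)
  let e : (ι → ℝ) ≃L[ℝ] (Fin (Fintype.card ι) → ℝ) :=
    ContinuousLinearEquiv.piCongrLeft ℝ (fun _ => ℝ) (Fintype.equivFin ι)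
  refine ⟨U ∩ V, fun y => e (f y), hU.inter hVo, ⟨hxU, hxV⟩,
    (e.contDiff.comp hf).contDiffOn, ?_, ?_⟩
  · intro y hy
    have hd : DifferentiableAt ℝ f y := (hf.differentiable (by simp)) y
    have : fderiv ℝ (fun y => e (f y)) y = (e : (ι → ℝ) →L[ℝ] _).comp (fderiv ℝ f y) :=
      (e.hasFDerivAt.comp y hd.hasFDerivAt).fderiv
    rw [this]
    exact e.surjective.comp (hV y hy.2)
  · rw [← Set.inter_assoc, hSU]
    ext y
    simp only [Set.mem_inter_iff, Set.mem_ofPred_eq, EmbeddingLike.map_eq_zero_iff]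
    tauto

theorem IsSubmanifoldOfCodim.preimage {S : Set F} {m : ℕ} (hS : IsSubmanifoldOfCodim S m)
    {φ : E → F} {ψ : F → E} (hφ : ContDiff ℝ ∞ φ) (hψ : ContDiff ℝ ∞ ψ)
    (hφψ : ∀ y, φ (ψ y) = y) (hψφ : ∀ x, ψ (φ x) = x) :
    IsSubmanifoldOfCodim (φ ⁻¹' S) m := by
  intro x hx
  obtain ⟨U, f, hU, hxU, hf, hs, hSU⟩ := hS (φ x) hx
  refine ⟨φ ⁻¹' U, f ∘ φ, hU.preimage hφ.continuous, hxU,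
    hf.comp hφ.contDiffOn (fun _ h => h), ?_, ?_⟩
  · intro y hy
    have hdφ : DifferentiableAt ℝ φ y := hφ.differentiable (by simp) y
    have hdψ : DifferentiableAt ℝ ψ (φ y) := hψ.differentiable (by simp) _
    have hdf : DifferentiableAt ℝ f (φ y) :=
      (hf.contDiffAt (hU.mem_nhds hy)).differentiableAt (by simp)
    have hsφ : Function.Surjective (fderiv ℝ φ y) := by
      intro v
      refine ⟨fderiv ℝ ψ (φ y) v, ?_⟩
      have h1 : HasFDerivAt (φ ∘ ψ) ((fderiv ℝ φ y).comp (fderiv ℝ ψ (φ y))) (φ y) := by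
        refine HasFDerivAt.comp (φ y) ?_ hdψ.hasFDerivAt
        rw [hψφ]; exact hdφ.hasFDerivAt
      have h2 : (φ ∘ ψ) = id := funext hφψ
      rw [h2] at h1
      exact congrArg (fun Q : F →L[ℝ] F => Q v) (h1.unique (hasFDerivAt_id _))
    rw [fderiv_comp y hdf hdφ]
    exact (hs _ hy).comp hsφ
  · ext y
    have := Set.ext_iff.1 hSU (φ y)
    simpa using this

end Submersions

/-! ### Prolongation of smooth maps to jets of curves -/

section Prolongation

variable {V V' : Type*} [NormedAddCommGroup V] [NormedSpace ℝ V]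
  [NormedAddCommGroup V'] [NormedSpace ℝ V']

/-- By the Faà di Bruno formula, the derivative of order `k` of a composite sees the inner curve
only through its `k`-jet. This makes `prolong` independent of the chosen representative. -/
theorem iteratedDeriv_comp_congr {θ : V → V'} (hθ : ContDiff ℝ ∞ θ) {u v : ℝ → V} {s t : ℝ} {k : ℕ}
    (hu : ContDiffAt ℝ ∞ u s) (hv : ContDiffAt ℝ ∞ v t)
    (h : ∀ i ≤ k, iteratedDeriv i u s = iteratedDeriv i v t) :
    iteratedDeriv k (fun x => θ (u x)) s = iteratedDeriv k (fun x => θ (v x)) t := by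
  have h0 : u s = v t := by simpa using h 0 (Nat.zero_le _)
  have e1 := iteratedDeriv_vcomp_eq_sum_orderedFinpartition (n := ∞) (i := k)
    hθ.contDiffAt hu (by exact_mod_cast le_top)
  have e2 := iteratedDeriv_vcomp_eq_sum_orderedFinpartition (n := ∞) (i := k)
    hθ.contDiffAt hv (by exact_mod_cast le_top)
  rw [Function.comp_def] at e1 e2
  rw [e1, e2]
  refine Finset.sum_congr rfl fun c _ => ?_
  rw [h0]
  congr 1
  funext j
  exact h _ (c.partSize_le j)

/-- The polynomial curve whose derivatives at `s` of orders at most `r` are the given vectors. -/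
noncomputable def taylorCurve {r : ℕ} (w : Fin (r + 1) → V) (s t : ℝ) : V :=
  ∑ i : Fin (r + 1), ((t - s) ^ (i : ℕ) / ((i : ℕ).factorial : ℝ)) • w i

theorem contDiff_taylorCurve {r : ℕ} (s : ℝ) :
    ContDiff ℝ ∞ (fun p : (Fin (r + 1) → V) × ℝ => taylorCurve p.1 s p.2) := by
  unfold taylorCurve
  refine ContDiff.sum fun i _ => ContDiff.smul ?_ ?_
  · fun_prop
  · fun_prop

theorem contDiff_taylorCurve_right {r : ℕ} (w : Fin (r + 1) → V) (s : ℝ) :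
    ContDiff ℝ ∞ (taylorCurve w s) :=
  (contDiff_taylorCurve s).comp (contDiff_const.prodMk contDiff_id)

theorem iteratedDeriv_monomial (m k : ℕ) (s : ℝ) :
    iteratedDeriv k (fun t : ℝ => (t - s) ^ m / (m.factorial : ℝ)) s = if k = m then 1 else 0 := by
  have h := iteratedDeriv_comp_sub_const k (fun t : ℝ => t ^ m / (m.factorial : ℝ)) s
  rw [h]
  simp only [sub_self]
  rw [iteratedDeriv_div_const, iteratedDeriv_fun_pow_zero]
  split_ifs with hk
  · exact div_self (Nat.cast_ne_zero.2 (Nat.factorial_ne_zero m))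
  · simp

theorem iteratedDeriv_taylorCurve {r : ℕ} (w : Fin (r + 1) → V) (s : ℝ) (k : Fin (r + 1)) :
    iteratedDeriv (k : ℕ) (taylorCurve w s) s = w k := by
  unfold taylorCurve
  rw [iteratedDeriv_fun_sum]
  · rw [Finset.sum_eq_single k]
    · rw [iteratedDeriv_smul_const, iteratedDeriv_monomial]
      · simp
      · fun_prop
    · intro i _ hi
      rw [iteratedDeriv_smul_const, iteratedDeriv_monomial, if_neg, zero_smul]
      · exact fun h => hi (Fin.ext h.symm)
      · fun_prop
    · simp
  · intro i _
    fun_prop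

/-- Each derivative in the last variable is a full derivative in the direction `(0, 1)`, so joint
smoothness persists by induction. -/
theorem contDiff_iteratedDeriv_param {f : V × ℝ → V'} (hf : ContDiff ℝ ∞ f) (k : ℕ) :
    ContDiff ℝ ∞ (fun p : V × ℝ => iteratedDeriv k (fun t => f (p.1, t)) p.2) := by
  induction k with
  | zero => simpa using hf
  | succ k ih =>
    have h : (fun p : V × ℝ => iteratedDeriv (k + 1) (fun t => f (p.1, t)) p.2) =
        fun p => fderiv ℝ (fun p : V × ℝ => iteratedDeriv k (fun t => f (p.1, t)) p.2) p (0, 1) := by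
      funext p
      rw [iteratedDeriv_succ]
      have h1 := ((ih.differentiable (by simp)) p).hasFDerivAt
      have h2 : HasDerivAt (fun t : ℝ => (p.1, t)) ((0 : V), (1 : ℝ)) p.2 :=
        (hasDerivAt_const _ _).prodMk (hasDerivAt_id _)
      exact (HasFDerivAt.comp_hasDerivAt (f := fun t : ℝ => (p.1, t)) p.2 h1 h2).deriv
    rw [h]
    exact (ih.fderiv_right (m := ∞) (by simp)).clm_apply contDiff_const

/-- The map induced on `r`-jets of curves by a smooth map. -/
noncomputable def prolong (r : ℕ) (θ : V → V') (w : Fin (r + 1) → V) : Fin (r + 1) → V' :=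
  fun k => iteratedDeriv (k : ℕ) (fun t => θ (taylorCurve w 0 t)) 0

theorem contDiff_prolong (r : ℕ) {θ : V → V'} (hθ : ContDiff ℝ ∞ θ) :
    ContDiff ℝ ∞ (prolong r θ) := by
  rw [contDiff_pi]
  intro k
  have h := contDiff_iteratedDeriv_param (hθ.comp (contDiff_taylorCurve (V := V) (r := r) 0)) k
  exact h.comp (contDiff_id.prodMk contDiff_const)

theorem prolong_jet (r : ℕ) {θ : V → V'} (hθ : ContDiff ℝ ∞ θ) {u : ℝ → V} {s : ℝ}
    (hu : ContDiffAt ℝ ∞ u s) :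
    prolong r θ (fun k : Fin (r + 1) => iteratedDeriv (k : ℕ) u s) =
      fun k : Fin (r + 1) => iteratedDeriv (k : ℕ) (fun t => θ (u t)) s := by
  funext k
  refine iteratedDeriv_comp_congr hθ (contDiff_taylorCurve_right _ _).contDiffAt hu fun i hi => ?_
  exact iteratedDeriv_taylorCurve _ 0 ⟨i, by omega⟩

theorem prolong_prolong (r : ℕ) {θ : V → V'} {θ' : V' → V} (hθ : ContDiff ℝ ∞ θ)
    (hθ' : ContDiff ℝ ∞ θ') (h : ∀ x, θ' (θ x) = x) (w : Fin (r + 1) → V) :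
    prolong r θ' (prolong r θ w) = w := by
  have h1 := prolong_jet r hθ' (u := fun t => θ (taylorCurve w 0 t)) (s := 0)
    (hθ.comp (contDiff_taylorCurve_right w 0)).contDiffAt
  have h2 : prolong r θ w =
    fun k : Fin (r + 1) => iteratedDeriv (k : ℕ) (fun t => θ (taylorCurve w 0 t)) 0 := rfl
  rw [h2, h1]
  funext k
  simp only [h]
  exact iteratedDeriv_taylorCurve w 0 k

end Prolongation

/-! ### Linear algebra of the affine cells and the contact form -/

section Algebra

variable {n : ℕ}

theorem lowerMat_of_lt (x : Coord n) {i j : Fin (n + 2)} (h : j < i) :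
    lowerMat x i j = x ⟨(i, j), h⟩ := by
  simp [lowerMat, h]

theorem lowerMat_self (x : Coord n) (i : Fin (n + 2)) : lowerMat x i i = 1 := by
  simp [lowerMat]

theorem lowerMat_of_gt (x : Coord n) {i j : Fin (n + 2)} (h : i < j) : lowerMat x i j = 0 := by
  simp [lowerMat, h.not_gt, h.ne]

theorem det_lowerMat (x : Coord n) : (lowerMat x).det = 1 := by
  rw [Matrix.det_of_isLowerTriangular]
  · simp [lowerMat_self]
  · intro i j h
    exact lowerMat_of_gt x h

theorem isUnit_det_chart (g : GL (Fin (n + 2)) ℝ) (x : Coord n) :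
    IsUnit ((g : Mat n) * lowerMat x).det := by
  rw [Matrix.det_mul, det_lowerMat, mul_one]
  exact (Matrix.isUnit_iff_isUnit_det _).1 g.isUnit

theorem mem_colSpan_iff (A : Mat n) (k : ℕ) (v : Vec n) :
    v ∈ colSpan A k ↔ ∃ c : Vec n, (∀ j : Fin (n + 2), k ≤ (j : ℕ) → c j = 0) ∧ A.mulVec c = v := by
  constructor
  · intro h
    induction h using Submodule.span_induction with
    | mem v hv =>
      obtain ⟨j, hj, rfl⟩ := hv
      refine ⟨Pi.single j 1, fun i hi => ?_, ?_⟩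
      · rw [Pi.single_eq_of_ne]
        rintro rfl
        omega
      · rw [Matrix.mulVec_single_one]
        rfl
    | zero => exact ⟨0, fun _ _ => rfl, Matrix.mulVec_zero _⟩
    | add v w _ _ hv hw =>
      obtain ⟨c, hc, rfl⟩ := hv
      obtain ⟨d, hd, rfl⟩ := hw
      exact ⟨c + d, fun j hj => by simp [hc j hj, hd j hj], Matrix.mulVec_add _ _ _⟩
    | smul a v _ hv =>
      obtain ⟨c, hc, rfl⟩ := hv
      exact ⟨a • c, fun j hj => by simp [hc j hj], Matrix.mulVec_smul _ _ _⟩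
  · rintro ⟨c, hc, rfl⟩
    rw [Matrix.mulVec_eq_sum]
    refine Submodule.sum_mem _ fun j _ => ?_
    by_cases hj : (j : ℕ) < k
    · have : A.transpose j ∈ colSpan A k := Submodule.subset_span ⟨j, hj, rfl⟩
      simpa using Submodule.smul_mem _ (c j) this
    · simp [hc j (not_lt.1 hj)]

theorem finrank_colSpan {A : Mat n} (hA : IsUnit A.det) {k : ℕ} (hk : k ≤ n + 2) :
    Module.finrank ℝ (colSpan A k) = k := by
  have hli : LinearIndependent ℝ A.col :=
    Matrix.linearIndependent_cols_iff_isUnit.2 ((Matrix.isUnit_iff_isUnit_det A).2 hA)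
  have hli' : LinearIndependent ℝ (fun j : Fin k => A.col (Fin.castLE hk j)) :=
    hli.comp _ (Fin.castLE_injective hk)
  have hs : colSpan A k = Submodule.span ℝ (Set.range fun j : Fin k => A.col (Fin.castLE hk j)) := by
    unfold colSpan
    congr 1
    ext v
    constructor
    · rintro ⟨j, hj, rfl⟩
      exact ⟨⟨j, hj⟩, rfl⟩
    · rintro ⟨j, rfl⟩
      exact ⟨Fin.castLE hk j, j.2, rfl⟩
  rw [hs, finrank_span_eq_card hli', Fintype.card_fin]

theorem colSpan_mono (A : Mat n) : Monotone (colSpan A) := by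
  intro k l hkl
  refine Submodule.span_mono ?_
  rintro v ⟨j, hj, rfl⟩
  exact ⟨j, hj.trans_le hkl, rfl⟩

/-- The flag with coordinates `x` in the chart given by `g`. -/
def chartFlag (g : GL (Fin (n + 2)) ℝ) (x : Coord n) : CompleteFlag n where
  V i := colSpan ((g : Mat n) * lowerMat x) ((i : ℕ) + 1)
  mono := fun i j h => colSpan_mono _ (Nat.succ_le_succ h)
  finrank_eq i := finrank_colSpan (isUnit_det_chart g x) (by omega)

theorem isChartCoord_chartFlag (g : GL (Fin (n + 2)) ℝ) (x : Coord n) :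
    IsChartCoord g x (chartFlag g x) := fun _ => rfl

/-- The index of the coordinate `x_{i+1}^0`. -/
def lineIdx (i : Fin (n + 1)) : {p : Fin (n + 2) × Fin (n + 2) // p.2 < p.1} :=
  ⟨(i.succ, 0), Fin.succ_pos i⟩

/-- The index of the coordinate `x_{n+1}^{j+1}`. -/
def dualIdx (j : Fin n) : {p : Fin (n + 2) × Fin (n + 2) // p.2 < p.1} :=
  ⟨(Fin.last (n + 1), j.castSucc.succ), by
    rw [Fin.lt_def]; simp⟩

theorem lineIdx_injective : Function.Injective (lineIdx (n := n)) := by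
  intro i j h
  simpa [lineIdx] using h

theorem dualIdx_injective : Function.Injective (dualIdx (n := n)) := by
  intro i j h
  simpa [dualIdx] using h

theorem lineIdx_ne_dualIdx (i : Fin (n + 1)) (j : Fin n) : lineIdx i ≠ dualIdx j := by
  intro h
  have h1 : (0 : Fin (n + 2)) = j.castSucc.succ := congrArg (fun p => p.1.2) h
  exact Fin.succ_ne_zero _ h1.symm

theorem lowerMat_zero_col (x : Coord n) :
    (fun i => lowerMat x i 0) = (Fin.cons 1 fun i => x (lineIdx i) : Vec n) := by
  funext i
  refine Fin.cases ?_ (fun i => ?_) i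
  · simp [lowerMat_self]
  · simp [lowerMat_of_lt x (Fin.succ_pos i), lineIdx]

theorem lineVec_eq (g : GL (Fin (n + 2)) ℝ) (x : Coord n) :
    lineVec g x = (g : Mat n).mulVec (Fin.cons 1 fun i => x (lineIdx i)) := by
  rw [← lowerMat_zero_col]
  rfl

theorem lineVec_ne_zero (g : GL (Fin (n + 2)) ℝ) (x : Coord n) : lineVec g x ≠ 0 := by
  rw [lineVec_eq]
  intro h
  have h1 := congrArg ((g⁻¹ : GL (Fin (n + 2)) ℝ) : Mat n).mulVec h
  rw [Matrix.mulVec_mulVec, ← Units.val_mul, inv_mul_cancel, Units.val_one, Matrix.one_mulVec,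
    Matrix.mulVec_zero] at h1
  simpa using congrFun h1 0

theorem IsChartCoord.line_eq {g : GL (Fin (n + 2)) ℝ} {x : Coord n} {F : CompleteFlag n}
    (h : IsChartCoord g x F) : F.line = Submodule.span ℝ {lineVec g x} := by
  rw [CompleteFlag.line, h 0, colSpan]
  congr 1
  ext v
  constructor
  · rintro ⟨j, hj, rfl⟩
    have : j = 0 := Fin.ext (by simpa using hj)
    subst this
    rfl
  · rintro rfl
    exact ⟨0, by simp, rfl⟩

/-- The linear part of `x ↦ lineVec g x`. -/
noncomputable def lineVecLinear (g : GL (Fin (n + 2)) ℝ) : Coord n →L[ℝ] Vec n :=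
  LinearMap.toContinuousLinearMap
    { toFun := fun v => (g : Mat n).mulVec (Fin.cons 0 fun i => v (lineIdx i))
      map_add' := fun v w => by
        rw [← Matrix.mulVec_add]
        congr 1
        funext i
        refine Fin.cases ?_ (fun i => ?_) i <;> simp
      map_smul' := fun c v => by
        rw [RingHom.id_apply, ← Matrix.mulVec_smul]
        congr 1
        funext i
        refine Fin.cases ?_ (fun i => ?_) i <;> simp }

theorem lineVecLinear_apply (g : GL (Fin (n + 2)) ℝ) (v : Coord n) :
    lineVecLinear g v = (g : Mat n).mulVec (Fin.cons 0 fun i => v (lineIdx i)) := rfl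

theorem lineVec_eq_add (g : GL (Fin (n + 2)) ℝ) (x : Coord n) :
    lineVec g x = lineVecLinear g x + lineVec g 0 := by
  rw [lineVec_eq, lineVec_eq, lineVecLinear_apply, ← Matrix.mulVec_add]
  congr 1
  funext i
  refine Fin.cases ?_ (fun i => ?_) i <;> simp

theorem hasFDerivAt_lineVec (g : GL (Fin (n + 2)) ℝ) (x : Coord n) :
    HasFDerivAt (lineVec g) (lineVecLinear g) x := by
  have h : lineVec g = fun x => lineVecLinear g x + lineVec g 0 := funext (lineVec_eq_add g)
  rw [h]
  exact (lineVecLinear g).hasFDerivAt.add_const _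

theorem contDiff_lineVec (g : GL (Fin (n + 2)) ℝ) : ContDiff ℝ ∞ (lineVec g) := by
  have h : lineVec g = fun x => lineVecLinear g x + lineVec g 0 := funext (lineVec_eq_add g)
  rw [h]
  exact (lineVecLinear g).contDiff.add contDiff_const

/-- The last row of the inverse of `lowerMat x`: a linear form with kernel `V_{n+1}`. -/
noncomputable def dualRow (x : Coord n) : Vec n := (lowerMat x).adjugate (Fin.last (n + 1))

theorem adjugate_mul_lowerMat (x : Coord n) : (lowerMat x).adjugate * lowerMat x = 1 := by
  rw [Matrix.adjugate_mul, det_lowerMat, one_smul]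

theorem lowerMat_mul_adjugate (x : Coord n) : lowerMat x * (lowerMat x).adjugate = 1 := by
  rw [Matrix.mul_adjugate, det_lowerMat, one_smul]

theorem dualRow_vecMul (x : Coord n) :
    Matrix.vecMul (dualRow x) (lowerMat x) = Pi.single (Fin.last (n + 1)) 1 := by
  funext j
  have := congrFun (congrFun (adjugate_mul_lowerMat x) (Fin.last (n + 1))) j
  rw [Matrix.mul_apply] at this
  rw [Matrix.vecMul, dotProduct]
  simp only [dualRow]
  rw [this, Matrix.one_apply, Pi.single_apply]
  simp [eq_comm]

theorem eq_dualRow_of_vecMul {x : Coord n} {ξ : Vec n}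
    (h : Matrix.vecMul ξ (lowerMat x) = Pi.single (Fin.last (n + 1)) 1) : ξ = dualRow x := by
  have h1 : Matrix.vecMul (Matrix.vecMul ξ (lowerMat x)) (lowerMat x).adjugate =
      Matrix.vecMul (Matrix.vecMul (dualRow x) (lowerMat x)) (lowerMat x).adjugate := by
    rw [h, dualRow_vecMul]
  simpa [Matrix.vecMul_vecMul, lowerMat_mul_adjugate] using h1

theorem vecMul_lowerMat_last (x : Coord n) (ξ : Vec n) :
    Matrix.vecMul ξ (lowerMat x) (Fin.last (n + 1)) = ξ (Fin.last (n + 1)) := by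
  rw [Matrix.vecMul, dotProduct, Fin.sum_univ_castSucc]
  simp [lowerMat_self, lowerMat_of_gt x (Fin.castSucc_lt_last _)]

theorem dualRow_last (x : Coord n) : dualRow x (Fin.last (n + 1)) = 1 := by
  rw [← vecMul_lowerMat_last x (dualRow x), dualRow_vecMul]
  simp

theorem mem_colSpan_chart_iff (g : GL (Fin (n + 2)) ℝ) (x : Coord n) (v : Vec n) :
    (g : Mat n).mulVec v ∈ colSpan ((g : Mat n) * lowerMat x) (n + 1) ↔ dualRow x ⬝ᵥ v = 0 := by
  rw [mem_colSpan_iff]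
  have hkey : ∀ c : Vec n, dualRow x ⬝ᵥ (lowerMat x).mulVec c = c (Fin.last (n + 1)) := by
    intro c
    rw [Matrix.dotProduct_mulVec, dualRow_vecMul]
    simp
  constructor
  · rintro ⟨c, hc, h⟩
    rw [← Matrix.mulVec_mulVec] at h
    have h1 := congrArg ((g⁻¹ : GL (Fin (n + 2)) ℝ) : Mat n).mulVec h
    simp only [Matrix.mulVec_mulVec, ← Matrix.mul_assoc] at h1
    rw [← Units.val_mul, inv_mul_cancel, Units.val_one, Matrix.one_mulVec, Matrix.one_mul] at h1
    rw [← h1, hkey]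
    exact hc _ (by simp)
  · intro h
    refine ⟨(lowerMat x).adjugate.mulVec v, fun j hj => ?_, ?_⟩
    · have : j = Fin.last (n + 1) := Fin.ext (by have := j.2; simp; omega)
      subst this
      exact h
    · rw [Matrix.mulVec_mulVec, Matrix.mul_assoc, lowerMat_mul_adjugate, Matrix.mul_one]

/-- The spanning vector has constant first entry before `g` is applied, so `y_0` drops out; the last
entry of `dualRow` is `1`. -/
theorem mem_pseudoContact_iff (g : GL (Fin (n + 2)) ℝ) (x v : Coord n) :
    v ∈ pseudoContact g x ↔ v (lineIdx (Fin.last n)) +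
      ∑ j : Fin n, dualRow x j.castSucc.succ * v (lineIdx j.castSucc) = 0 := by
  rw [pseudoContact, Submodule.mem_comap, (hasFDerivAt_lineVec g x).fderiv]
  change lineVecLinear g v ∈ _ ↔ _
  rw [lineVecLinear_apply, mem_colSpan_chart_iff, dotProduct, Fin.sum_univ_succ,
    Fin.sum_univ_castSucc]
  simp [dualRow_last, add_comm]

end Algebra

/-! ### Coordinates adapted to the contact form -/

section Straightening

variable {n : ℕ}

/-- The change of coordinates that replaces `x_{n+1}^j`, `1 ≤ j ≤ n`, by the entries of the linear
form that defines `V_{n+1}`. -/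
noncomputable def straighten (x : Coord n) : Coord n := fun p =>
  if p.1.1 = Fin.last (n + 1) ∧ p.1.2 ≠ 0 then dualRow x p.1.2 else x p

/-- The inverse of `straighten`. -/
noncomputable def unstraighten (y : Coord n) : Coord n := fun p =>
  if p.1.1 = Fin.last (n + 1) ∧ p.1.2 ≠ 0 then
    -∑ k : Fin (n + 1), lowerMat y (Fin.last (n + 1)) k.castSucc * lowerMat y k.castSucc p.1.2
  else y p

theorem straighten_lineIdx (x : Coord n) (i : Fin (n + 1)) :
    straighten x (lineIdx i) = x (lineIdx i) := by
  simp [straighten, lineIdx]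

theorem straighten_dualIdx (x : Coord n) (j : Fin n) :
    straighten x (dualIdx j) = dualRow x j.castSucc.succ := by
  simp [straighten, dualIdx]

/-- Column `j ≥ 1` of `dualRow x * lowerMat x = e_{n+1}` expresses `x_{n+1}^j` through the dual row
and the rows above the last. The entry `y_0`, which `straighten` discards, is multiplied there by an
entry above the diagonal, which is `0`. -/
theorem unstraighten_straighten (x : Coord n) : unstraighten (straighten x) = x := by
  funext p
  obtain ⟨⟨i, j⟩, hij⟩ := p
  by_cases h : i = Fin.last (n + 1) ∧ j ≠ 0
  · obtain ⟨rfl, hj⟩ := h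
    have h1 := congrFun (dualRow_vecMul x) j
    rw [Matrix.vecMul, dotProduct, Fin.sum_univ_castSucc, dualRow_last,
      Pi.single_eq_of_ne (ne_of_lt hij), lowerMat_of_lt x hij] at h1
    simp only [unstraighten, ne_eq, hj, not_false_eq_true, and_self, if_true]
    rw [neg_eq_iff_eq_neg, eq_neg_iff_add_eq_zero]
    rw [one_mul] at h1
    rw [← h1]
    congr 1
    refine Finset.sum_congr rfl fun k _ => ?_
    have e1 : lowerMat (straighten x) k.castSucc j = lowerMat x k.castSucc j := by
      have hk : k.castSucc ≠ Fin.last (n + 1) := (Fin.castSucc_lt_last k).ne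
      simp [lowerMat, straighten, hk]
    rw [e1]
    by_cases hk0 : k = 0
    · subst hk0
      have : lowerMat x (Fin.castSucc 0) j = 0 :=
        lowerMat_of_gt x (by simpa using Fin.pos_iff_ne_zero.2 hj)
      rw [this, mul_zero, mul_zero]
    · rw [lowerMat_of_lt _ (Fin.castSucc_lt_last k)]
      have : k.castSucc ≠ 0 := by simpa using hk0
      simp [straighten, hk0]
  · rw [unstraighten, if_neg h, straighten, if_neg h]

theorem straighten_unstraighten (y : Coord n) : straighten (unstraighten y) = y := by
  have hrow : ∀ (k : Fin (n + 1)) j,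
      lowerMat (unstraighten y) k.castSucc j = lowerMat y k.castSucc j := by
    intro k j
    have hk : k.castSucc ≠ Fin.last (n + 1) := (Fin.castSucc_lt_last k).ne
    simp [lowerMat, unstraighten, hk]
  -- The candidate dual row: entries with index at least `1` are read off the last row of `y`, and
  -- the entry at `0` is forced by column `0`.
  let ξ : Vec n := fun j => if j = 0 then
      -(lowerMat y (Fin.last (n + 1)) 0 + ∑ k : Fin n,
        lowerMat y (Fin.last (n + 1)) k.succ.castSucc * lowerMat y k.succ.castSucc 0)
    else lowerMat y (Fin.last (n + 1)) j
  have hlast : ξ (Fin.last (n + 1)) = 1 := by simp [ξ, lowerMat_self]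
  have hξ : ξ = dualRow (unstraighten y) := by
    apply eq_dualRow_of_vecMul
    funext j
    refine Fin.lastCases ?_ (fun j => ?_) j
    · rw [vecMul_lowerMat_last, hlast, Pi.single_eq_same]
    · rw [Pi.single_eq_of_ne (Fin.castSucc_lt_last j).ne, Matrix.vecMul, dotProduct,
        Fin.sum_univ_castSucc, hlast, one_mul, lowerMat_of_lt _ (Fin.castSucc_lt_last j)]
      simp only [hrow]
      by_cases hj : j = 0
      · subst hj
        rw [Fin.sum_univ_succ]
        simp only [unstraighten, Fin.castSucc_zero, ne_eq, not_true_eq_false, and_false, if_false]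
        rw [lowerMat_self, ← lowerMat_of_lt y (Fin.last_pos)]
        simp [ξ]
      · have hj' : j.castSucc ≠ 0 := by simpa using hj
        simp only [unstraighten, ne_eq, hj', not_false_eq_true, and_self, if_true]
        rw [add_neg_eq_zero]
        refine Finset.sum_congr rfl fun k _ => ?_
        by_cases hk : k = 0
        · subst hk
          rw [lowerMat_of_gt y (i := Fin.castSucc 0) (j := j.castSucc), mul_zero, mul_zero]
          simpa using Fin.pos_iff_ne_zero.2 hj
        · simp [ξ, hk]
  funext p
  obtain ⟨⟨i, j⟩, hij⟩ := p
  by_cases h : i = Fin.last (n + 1) ∧ j ≠ 0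
  · rw [straighten, if_pos h, ← hξ]
    obtain ⟨rfl, hj⟩ := h
    simp only [ξ]
    rw [if_neg hj, lowerMat_of_lt y hij]
  · rw [straighten, if_neg h, unstraighten, if_neg h]

theorem contDiff_matrix_det {E ι : Type*} [NormedAddCommGroup E] [NormedSpace ℝ E] [Fintype ι]
    [DecidableEq ι] {A : E → Matrix ι ι ℝ} (hA : ∀ i j, ContDiff ℝ ∞ fun x => A x i j) :
    ContDiff ℝ ∞ fun x => (A x).det := by
  simp only [Matrix.det_apply]
  refine ContDiff.sum fun σ _ => ContDiff.const_smul _ ?_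
  exact contDiff_prod fun i _ => hA _ _

theorem contDiff_lowerMat (i j : Fin (n + 2)) : ContDiff ℝ ∞ fun x : Coord n => lowerMat x i j := by
  simp only [lowerMat, Matrix.of_apply]
  split_ifs
  · exact contDiff_apply _ _ _
  · exact contDiff_const
  · exact contDiff_const

theorem contDiff_dualRow (j : Fin (n + 2)) : ContDiff ℝ ∞ fun x : Coord n => dualRow x j := by
  simp only [dualRow, Matrix.adjugate_apply]
  refine contDiff_matrix_det fun i k => ?_
  simp only [Matrix.updateRow_apply]
  split_ifs
  · exact contDiff_const
  · exact contDiff_lowerMat _ _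

theorem contDiff_straighten : ContDiff ℝ ∞ (straighten (n := n)) := by
  rw [contDiff_pi]
  intro p
  simp only [straighten]
  split_ifs
  · exact contDiff_dualRow _
  · exact contDiff_apply _ _ _

theorem contDiff_unstraighten : ContDiff ℝ ∞ (unstraighten (n := n)) := by
  rw [contDiff_pi]
  intro p
  simp only [unstraighten]
  split_ifs
  · exact (ContDiff.sum fun k _ => (contDiff_lowerMat _ _).mul (contDiff_lowerMat _ _)).neg
  · exact contDiff_apply _ _ _

theorem mem_pseudoContact_iff_straighten (g : GL (Fin (n + 2)) ℝ) (x v : Coord n) :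
    v ∈ pseudoContact g x ↔ v (lineIdx (Fin.last n)) +
      ∑ j : Fin n, straighten x (dualIdx j) * v (lineIdx j.castSucc) = 0 := by
  simp only [mem_pseudoContact_iff, straighten_dualIdx]

end Straightening

/-! ### Independence of lifts and of local coordinates -/

section Lifts

variable {n : ℕ}

/-- The span of the derivatives of `γ` at `t` of orders `0, …, k`. -/
noncomputable def derivSpan (γ : ℝ → Vec n) (t : ℝ) (k : ℕ) : Submodule ℝ (Vec n) :=
  Submodule.span ℝ (Set.range fun i : Fin (k + 1) => iteratedDeriv (i : ℕ) γ t)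

theorem iteratedDeriv_mem_derivSpan (γ : ℝ → Vec n) (t : ℝ) {i k : ℕ} (h : i ≤ k) :
    iteratedDeriv i γ t ∈ derivSpan γ t k :=
  Submodule.subset_span ⟨⟨i, by omega⟩, rfl⟩

theorem rank_derivMatrix (γ : ℝ → Vec n) (t : ℝ) (k : ℕ) :
    (derivMatrix γ t k).rank = Module.finrank ℝ (derivSpan γ t k) := by
  rw [Matrix.rank_eq_finrank_span_cols]
  rfl

theorem contDiffOn_iteratedDeriv {V : Type*} [NormedAddCommGroup V] [NormedSpace ℝ V] {f : ℝ → V}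
    {W : Set ℝ} (hW : IsOpen W) (hf : ContDiffOn ℝ ∞ f W) (k : ℕ) :
    ContDiffOn ℝ ∞ (iteratedDeriv k f) W := by
  induction k with
  | zero => simpa using hf
  | succ k ih =>
    rw [iteratedDeriv_succ]
    exact ih.deriv_of_isOpen hW (by simp)

/-- Rescaling and reparametrising act triangularly on derivatives, so spans of derivatives up to a
given order can only shrink. The symmetric argument later gives equality. -/
theorem exists_iteratedDeriv_smul_comp {γ₁ γ₂ : ℝ → Vec n} {τ μ : ℝ → ℝ} {W W₁ : Set ℝ}
    (hW : IsOpen W) (hW₁ : IsOpen W₁) (hτ : ContDiffOn ℝ ∞ τ W) (hμ : ContDiffOn ℝ ∞ μ W)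
    (hγ₁ : ContDiffOn ℝ ∞ γ₁ W₁) (hmaps : Set.MapsTo τ W W₁)
    (h : ∀ s ∈ W, γ₂ s = μ s • γ₁ (τ s)) (k : ℕ) :
    ∃ c : ℕ → ℝ → ℝ, (∀ i, ContDiffOn ℝ ∞ (c i) W) ∧ ∀ s ∈ W,
      iteratedDeriv k γ₂ s = ∑ i ∈ Finset.range (k + 1), c i s • iteratedDeriv i γ₁ (τ s) := by
  induction k with
  | zero => exact ⟨fun _ => μ, fun _ => hμ, fun s hs => by simp [h s hs]⟩
  | succ k ih =>
    obtain ⟨c, hc, hk⟩ := ih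
    have hdc : ∀ i, ContDiffOn ℝ ∞ (deriv (c i)) W := fun i =>
      (hc i).deriv_of_isOpen hW (by simp)
    have hdτ : ContDiffOn ℝ ∞ (deriv τ) W := hτ.deriv_of_isOpen hW (by simp)
    -- Product and chain rule. The guard `i ≤ k` is needed because the induction hypothesis says
    -- nothing about the values of `c i` for `i > k`.
    refine ⟨fun i s => (if i ≤ k then deriv (c i) s else 0) +
      (if 1 ≤ i then c (i - 1) s * deriv τ s else 0), fun i => ?_, fun s hs => ?_⟩
    · refine ContDiffOn.add ?_ ?_
      · split_ifs
        · exact hdc i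
        · exact contDiffOn_const
      · split_ifs
        · exact (hc _).mul hdτ
        · exact contDiffOn_const
    · have hev : iteratedDeriv k γ₂ =ᶠ[nhds s]
          fun s => ∑ i ∈ Finset.range (k + 1), c i s • iteratedDeriv i γ₁ (τ s) :=
        Filter.eventually_of_mem (hW.mem_nhds hs) hk
      have hd : HasDerivAt (fun s => ∑ i ∈ Finset.range (k + 1), c i s • iteratedDeriv i γ₁ (τ s))
          (∑ i ∈ Finset.range (k + 1), (c i s • (deriv τ s • iteratedDeriv (i + 1) γ₁ (τ s)) +
            deriv (c i) s • iteratedDeriv i γ₁ (τ s))) s := by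
        refine HasDerivAt.fun_sum fun i _ => ?_
        have h1 : HasDerivAt (c i) (deriv (c i) s) s :=
          (((hc i).contDiffAt (hW.mem_nhds hs)).differentiableAt (by simp)).hasDerivAt
        have h2 : HasDerivAt τ (deriv τ s) s :=
          ((hτ.contDiffAt (hW.mem_nhds hs)).differentiableAt (by simp)).hasDerivAt
        have h3 : HasDerivAt (iteratedDeriv i γ₁) (iteratedDeriv (i + 1) γ₁ (τ s)) (τ s) := by
          rw [iteratedDeriv_succ]
          refine DifferentiableAt.hasDerivAt ?_
          exact ((contDiffOn_iteratedDeriv hW₁ hγ₁ i).contDiffAt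
            (hW₁.mem_nhds (hmaps hs))).differentiableAt (by simp)
        exact h1.smul (h3.scomp s h2)
      rw [iteratedDeriv_succ, hev.deriv_eq, hd.deriv]
      simp only [add_smul, Finset.sum_add_distrib]
      rw [add_comm]
      congr 1
      · rw [Finset.sum_range_succ _ (k + 1)]
        simp only [Nat.not_succ_le_self, if_false, zero_smul, add_zero]
        refine Finset.sum_congr rfl fun i hi => ?_
        rw [if_pos (by simpa [Nat.lt_succ_iff] using hi)]
      · rw [Finset.sum_range_succ' _ (k + 1)]
        simp [mul_smul]

theorem derivSpan_smul_comp_le {γ₁ γ₂ : ℝ → Vec n} {τ μ : ℝ → ℝ} {W W₁ : Set ℝ}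
    (hW : IsOpen W) (hW₁ : IsOpen W₁) (hτ : ContDiffOn ℝ ∞ τ W) (hμ : ContDiffOn ℝ ∞ μ W)
    (hγ₁ : ContDiffOn ℝ ∞ γ₁ W₁) (hmaps : Set.MapsTo τ W W₁)
    (h : ∀ s ∈ W, γ₂ s = μ s • γ₁ (τ s)) (k : ℕ) {s : ℝ} (hs : s ∈ W) :
    derivSpan γ₂ s k ≤ derivSpan γ₁ (τ s) k := by
  refine Submodule.span_le.2 ?_
  rintro _ ⟨i, rfl⟩
  obtain ⟨c, -, hc⟩ := exists_iteratedDeriv_smul_comp hW hW₁ hτ hμ hγ₁ hmaps h i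
  change iteratedDeriv (i : ℕ) γ₂ s ∈ _
  rw [hc s hs]
  refine Submodule.sum_mem _ fun j hj => Submodule.smul_mem _ _ ?_
  exact iteratedDeriv_mem_derivSpan _ _ (by have := i.2; simp at hj; omega)

variable {I : Type*} [TopologicalSpace I] [ChartedSpace ℝ I]

/-- In the local coordinate `κ` of `I`, on the open set `W`, the curve of lines `π_1 ∘ Γ` has the
smooth lift `γ` to `ℝ^{n+2} ∖ {0}`. -/
structure IsLift (Γ : I → CompleteFlag n) (κ : OpenPartialHomeomorph I ℝ) (γ : ℝ → Vec n)
    (W : Set ℝ) : Prop where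
  mem_atlas : κ ∈ atlas ℝ I
  isOpen : IsOpen W
  subset : W ⊆ κ.target
  smooth : ContDiffOn ℝ ∞ γ W
  line_eq : ∀ s ∈ W, γ s ≠ 0 ∧ (Γ (κ.symm s)).line = Submodule.span ℝ {γ s}

theorem IsLocalExpr.isLift {Γ : I → CompleteFlag n} {κ : OpenPartialHomeomorph I ℝ}
    {g : GL (Fin (n + 2)) ℝ} {u : ℝ → Coord n} {W : Set ℝ} (h : IsLocalExpr Γ κ g u W) :
    IsLift Γ κ (fun s => lineVec g (u s)) W where
  mem_atlas := h.mem_atlas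
  isOpen := h.isOpen
  subset := h.subset
  smooth := (contDiff_lineVec g).comp_contDiffOn h.smooth
  line_eq s hs := ⟨lineVec_ne_zero _ _, (h.expr s hs).line_eq⟩

theorem contDiffOn_transition [IsManifold 𝓘(ℝ, ℝ) ∞ I] {κ₁ κ₂ : OpenPartialHomeomorph I ℝ}
    (h₁ : κ₁ ∈ atlas ℝ I) (h₂ : κ₂ ∈ atlas ℝ I) :
    ContDiffOn ℝ ∞ (fun s => κ₁ (κ₂.symm s)) (κ₂.target ∩ κ₂.symm ⁻¹' κ₁.source) := by
  have h := HasGroupoid.compatible (G := contDiffGroupoid ∞ 𝓘(ℝ, ℝ)) h₂ h₁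
  rw [contDiffGroupoid, mem_groupoid_of_pregroupoid] at h
  simpa [contDiffPregroupoid, Function.comp_def] using h.1

theorem IsLift.derivSpan_le [IsManifold 𝓘(ℝ, ℝ) ∞ I] {Γ : I → CompleteFlag n}
    {κ₁ κ₂ : OpenPartialHomeomorph I ℝ} {γ₁ γ₂ : ℝ → Vec n} {W₁ W₂ : Set ℝ}
    (h₁ : IsLift Γ κ₁ γ₁ W₁) (h₂ : IsLift Γ κ₂ γ₂ W₂) {p : I} (hp₁ : p ∈ κ₁.source)
    (hp₂ : p ∈ κ₂.source) (hm₁ : κ₁ p ∈ W₁) (hm₂ : κ₂ p ∈ W₂) (k : ℕ) :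
    derivSpan γ₂ (κ₂ p) k ≤ derivSpan γ₁ (κ₁ p) k := by
  -- Where this component is nonzero, the proportionality factor of the two lifts is a quotient of
  -- components, hence smooth.
  obtain ⟨i, hi⟩ : ∃ i, γ₁ (κ₁ p) i ≠ 0 := Function.ne_iff.1 (h₁.line_eq _ hm₁).1
  have hW₁' : IsOpen (W₁ ∩ (fun s => γ₁ s i) ⁻¹' {0}ᶜ) := by
    refine ContinuousOn.isOpen_inter_preimage ?_ h₁.isOpen isOpen_compl_singleton
    exact (continuous_apply i).comp_continuousOn h₁.smooth.continuousOn
  have hτ := contDiffOn_transition h₁.mem_atlas h₂.mem_atlas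
  have hT : IsOpen (κ₂.target ∩ κ₂.symm ⁻¹' κ₁.source) :=
    κ₂.isOpen_inter_preimage_symm κ₁.open_source
  have hN : IsOpen ((κ₂.target ∩ κ₂.symm ⁻¹' κ₁.source) ∩ (fun s => κ₁ (κ₂.symm s)) ⁻¹'
      (W₁ ∩ (fun s => γ₁ s i) ⁻¹' {0}ᶜ)) :=
    hτ.continuousOn.isOpen_inter_preimage hT hW₁'
  set N := (κ₂.target ∩ κ₂.symm ⁻¹' κ₁.source) ∩ (fun s => κ₁ (κ₂.symm s)) ⁻¹'
      (W₁ ∩ (fun s => γ₁ s i) ⁻¹' {0}ᶜ) with hNdef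
  have hmaps : Set.MapsTo (fun s => κ₁ (κ₂.symm s)) (N ∩ W₂) W₁ := fun s hs => hs.1.2.1
  have hτ' : ContDiffOn ℝ ∞ (fun s => κ₁ (κ₂.symm s)) (N ∩ W₂) := hτ.mono fun s hs => hs.1.1
  have hp : κ₂ p ∈ N ∩ W₂ := by
    refine ⟨⟨⟨κ₂.map_source hp₂, ?_⟩, ?_⟩, hm₂⟩
    · simpa [κ₂.left_inv hp₂] using hp₁
    · simp only [Set.mem_preimage, κ₂.left_inv hp₂]
      exact ⟨hm₁, hi⟩
  have key := derivSpan_smul_comp_le (γ₁ := γ₁) (γ₂ := γ₂) (τ := fun s => κ₁ (κ₂.symm s))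
    (μ := fun s => γ₂ s i / γ₁ (κ₁ (κ₂.symm s)) i) (W := N ∩ W₂) (W₁ := W₁)
    (hN.inter h₂.isOpen) h₁.isOpen hτ' ?_ h₁.smooth hmaps ?_ k hp
  · simpa [κ₂.left_inv hp₂] using key
  · refine ContDiffOn.div ?_ ?_ fun s hs => hs.1.2.2
    · exact (contDiff_apply ℝ ℝ i).comp_contDiffOn (h₂.smooth.mono fun s hs => hs.2)
    · exact (contDiff_apply ℝ ℝ i).comp_contDiffOn (h₁.smooth.comp hτ' hmaps)
  · intro s hs
    have e1 := (h₁.line_eq _ (hmaps hs)).2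
    have e2 := (h₂.line_eq _ hs.2).2
    rw [κ₁.left_inv hs.1.1.2, e2] at e1
    have hmem : γ₂ s ∈ Submodule.span ℝ {γ₁ (κ₁ (κ₂.symm s))} := by
      rw [← e1]
      exact Submodule.mem_span_singleton_self _
    obtain ⟨c, hc⟩ := Submodule.mem_span_singleton.1 hmem
    have hne : γ₁ (κ₁ (κ₂.symm s)) i ≠ 0 := hs.1.2.2
    have : γ₂ s i / γ₁ (κ₁ (κ₂.symm s)) i = c := by
      rw [← hc]
      simp [hne]
    simp only [this, hc]

theorem IsLift.derivSpan_eq [IsManifold 𝓘(ℝ, ℝ) ∞ I] {Γ : I → CompleteFlag n}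
    {κ₁ κ₂ : OpenPartialHomeomorph I ℝ} {γ₁ γ₂ : ℝ → Vec n} {W₁ W₂ : Set ℝ}
    (h₁ : IsLift Γ κ₁ γ₁ W₁) (h₂ : IsLift Γ κ₂ γ₂ W₂) {p : I} (hp₁ : p ∈ κ₁.source)
    (hp₂ : p ∈ κ₂.source) (hm₁ : κ₁ p ∈ W₁) (hm₂ : κ₂ p ∈ W₂) (k : ℕ) :
    derivSpan γ₁ (κ₁ p) k = derivSpan γ₂ (κ₂ p) k :=
  le_antisymm (h₂.derivSpan_le h₁ hp₂ hp₁ hm₂ hm₁ k) (h₁.derivSpan_le h₂ hp₁ hp₂ hm₁ hm₂ k)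

theorem projIsOfType_iff [IsManifold 𝓘(ℝ, ℝ) ∞ I] {Γ : I → CompleteFlag n}
    {κ : OpenPartialHomeomorph I ℝ} {γ : ℝ → Vec n} {W : Set ℝ} (h : IsLift Γ κ γ W) {t : I}
    (ht : t ∈ κ.source) (hm : κ t ∈ W) (a : Fin (n + 1) → ℕ) :
    ProjIsOfType Γ t a ↔ IsOfType γ (κ t) a := by
  constructor
  · rintro ⟨κ', hκ', ht', W', γ', hW', hm', hsub, hsm, hline, htype⟩
    have h' : IsLift Γ κ' γ' W' := ⟨hκ', hW', hsub, hsm, hline⟩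
    intro i
    have hrank : ∀ k, (derivMatrix γ' (κ' t) k).rank = (derivMatrix γ (κ t) k).rank := fun k => by
      rw [rank_derivMatrix, rank_derivMatrix, h'.derivSpan_eq h ht' ht hm' hm]
    simpa only [hrank] using htype i
  · intro htype
    exact ⟨κ, h.mem_atlas, ht, W, γ, h.isOpen, hm, h.subset, h.smooth, h.line_eq, htype⟩

/-- Integrality in terms of the lift alone, which allows it to be transferred between charts. -/
theorem mem_pseudoContact_iff_deriv_mem {Γ : I → CompleteFlag n} {κ : OpenPartialHomeomorph I ℝ}
    {g : GL (Fin (n + 2)) ℝ} {u : ℝ → Coord n} {W : Set ℝ} (h : IsLocalExpr Γ κ g u W)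
    {s : ℝ} (hs : s ∈ W) :
    deriv u s ∈ pseudoContact g (u s) ↔
      deriv (fun s => lineVec g (u s)) s ∈ (Γ (κ.symm s)).V (Fin.last n) := by
  have hu : HasDerivAt u (deriv u s) s :=
    ((h.smooth.contDiffAt (h.isOpen.mem_nhds hs)).differentiableAt (by simp)).hasDerivAt
  have h1 : HasDerivAt (fun s => lineVec g (u s)) (lineVecLinear g (deriv u s)) s :=
    (hasFDerivAt_lineVec g (u s)).comp_hasDerivAt s hu
  rw [h1.deriv, h.expr s hs (Fin.last n), pseudoContact, Submodule.mem_comap,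
    (hasFDerivAt_lineVec g (u s)).fderiv]
  rfl

theorem IsLocalExpr.line_mem {Γ : I → CompleteFlag n} {κ : OpenPartialHomeomorph I ℝ}
    {g : GL (Fin (n + 2)) ℝ} {u : ℝ → Coord n} {W : Set ℝ} (h : IsLocalExpr Γ κ g u W)
    {s : ℝ} (hs : s ∈ W) : lineVec g (u s) ∈ (Γ (κ.symm s)).V (Fin.last n) := by
  refine (Γ (κ.symm s)).mono (Fin.zero_le _) ?_
  have := (h.expr s hs).line_eq
  rw [CompleteFlag.line] at this
  rw [this]
  exact Submodule.mem_span_singleton_self _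

theorem IsIntegralNear.eventually_mem_pseudoContact [IsManifold 𝓘(ℝ, ℝ) ∞ I]
    {Γ : I → CompleteFlag n} {t : I} (hΓ : IsIntegralNear Γ t) {κ : OpenPartialHomeomorph I ℝ}
    {g : GL (Fin (n + 2)) ℝ} {u : ℝ → Coord n} {W : Set ℝ} (h : IsLocalExpr Γ κ g u W)
    (ht : t ∈ κ.source) (hm : κ t ∈ W) :
    ∀ᶠ s in nhds (κ t), deriv u s ∈ pseudoContact g (u s) := by
  obtain ⟨κ', g', u', W', h', ht', hm', hintegral⟩ := hΓ
  have hcont : ContinuousAt κ.symm (κ t) := κ.continuousAt_symm (κ.map_source ht)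
  have hsrc : ∀ᶠ s in nhds (κ t), κ.symm s ∈ κ'.source := by
    refine hcont.eventually ?_
    rw [κ.left_inv ht]
    exact κ'.open_source.mem_nhds ht'
  have hW' : ∀ᶠ s in nhds (κ t), κ' (κ.symm s) ∈ W' := by
    refine hcont.eventually (p := fun q => κ' q ∈ W') ?_
    rw [κ.left_inv ht]
    exact (κ'.continuousAt ht').eventually (h'.isOpen.mem_nhds hm')
  filter_upwards [h.isOpen.mem_nhds hm, hsrc, hW'] with s hs h1 h2
  rw [mem_pseudoContact_iff_deriv_mem h hs]
  have hst : s ∈ κ.target := h.subset hs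
  -- Order `1` suffices: the velocity of one lift is a combination of the other lift and its
  -- velocity, and both of these lie in `V_{n+1}`.
  have hle := h'.isLift.derivSpan_le h.isLift h1 (κ.map_target hst) h2
    (by rwa [κ.right_inv hst]) 1
  rw [κ.right_inv hst] at hle
  have hmem := hle (iteratedDeriv_mem_derivSpan _ _ le_rfl)
  rw [iteratedDeriv_one] at hmem
  refine (Submodule.span_le.2 ?_ : derivSpan _ _ 1 ≤ _) hmem
  rintro _ ⟨i, rfl⟩
  fin_cases i
  · have := h'.line_mem h2
    rw [κ'.left_inv h1] at this
    simpa using this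
  · have := (mem_pseudoContact_iff_deriv_mem h' h2).1 (hintegral _ h2)
    rw [κ'.left_inv h1] at this
    simpa using this

end Lifts

/-! ### Type of a curve through Cramer coordinates -/

section Types

variable {n : ℕ}

/-- The span of the vectors `v 0, …, v k`. -/
def spanUpTo (v : ℕ → Vec n) (k : ℕ) : Submodule ℝ (Vec n) :=
  Submodule.span ℝ (Set.range fun i : Fin (k + 1) => v i)

/-- The matrix with columns `v (b j)`. -/
def pickCols (v : ℕ → Vec n) (b : Fin (n + 2) → ℕ) : Mat n := Matrix.of fun i j => v (b j) i

theorem mem_spanUpTo (v : ℕ → Vec n) {i k : ℕ} (h : i ≤ k) : v i ∈ spanUpTo v k :=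
  Submodule.subset_span ⟨⟨i, by omega⟩, rfl⟩

theorem spanUpTo_le {v : ℕ → Vec n} {k : ℕ} {S : Submodule ℝ (Vec n)} (h : ∀ i ≤ k, v i ∈ S) :
    spanUpTo v k ≤ S := by
  refine Submodule.span_le.2 ?_
  rintro _ ⟨i, rfl⟩
  exact h i (by omega)

theorem spanUpTo_mono (v : ℕ → Vec n) : Monotone (spanUpTo v) := fun _ _ h =>
  spanUpTo_le fun _ hi => mem_spanUpTo v (hi.trans h)

theorem colSpan_pickCols_le {v : ℕ → Vec n} {b : Fin (n + 2) → ℕ} {k c : ℕ}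
    (h : ∀ j : Fin (n + 2), (j : ℕ) < k → b j ≤ c) : colSpan (pickCols v b) k ≤ spanUpTo v c := by
  refine Submodule.span_le.2 ?_
  rintro _ ⟨j, hj, rfl⟩
  exact mem_spanUpTo v (h j hj)

theorem cramer_mulVec (B : Mat n) (e : Vec n) : B.cramer (B.mulVec e) = B.det • e := by
  rw [Matrix.cramer_eq_adjugate_mulVec, Matrix.mulVec_mulVec, Matrix.adjugate_mul,
    Matrix.smul_mulVec, Matrix.one_mulVec]

theorem mem_colSpan_iff_cramer {B : Mat n} (hB : B.det ≠ 0) (k : ℕ) (v : Vec n) :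
    v ∈ colSpan B k ↔ ∀ j : Fin (n + 2), k ≤ (j : ℕ) → B.cramer v j = 0 := by
  rw [mem_colSpan_iff]
  constructor
  · rintro ⟨c, hc, rfl⟩ j hj
    rw [cramer_mulVec, Pi.smul_apply, hc j hj, smul_zero]
  · intro h
    refine ⟨B.det⁻¹ • B.cramer v, fun j hj => by simp [h j hj], ?_⟩
    rw [Matrix.mulVec_smul, Matrix.mulVec_cramer, smul_smul, inv_mul_cancel₀ hB, one_smul]

/-- The vanishing coordinates confine `v 0, …, v c` to the columns of order at most `c`; hence the
dimension of the span goes up exactly at the orders of the basis. `cramer` is used instead of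
coordinates in the basis because it is polynomial in the matrix. -/
theorem finrank_spanUpTo_of_cramer {v : ℕ → Vec n} {a : Fin (n + 1) → ℕ}
    (ha : StrictMono (Fin.cons 0 a : Fin (n + 2) → ℕ))
    (hdet : (pickCols v (Fin.cons 0 a)).det ≠ 0)
    (hcr : ∀ (j : Fin (n + 2)) (c : ℕ), c < (Fin.cons 0 a : Fin (n + 2) → ℕ) j →
      (pickCols v (Fin.cons 0 a)).cramer (v c) j = 0) (i : Fin (n + 1)) :
    IsLeast {k | Module.finrank ℝ (spanUpTo v k) = (i : ℕ) + 2} (a i) := by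
  set b : Fin (n + 2) → ℕ := Fin.cons 0 a with hb
  have hbi : b i.succ = a i := by simp [hb]
  have hle : ∀ k c : ℕ, (∀ j : Fin (n + 2), k ≤ (j : ℕ) → c < b j) →
      spanUpTo v c ≤ colSpan (pickCols v b) k := by
    intro k c h
    refine spanUpTo_le fun e he => ?_
    rw [mem_colSpan_iff_cramer hdet]
    exact fun j hj => hcr j e (he.trans_lt (h j hj))
  constructor
  · have h1 : spanUpTo v (a i) = colSpan (pickCols v b) ((i : ℕ) + 2) := by
      refine le_antisymm (hle _ _ fun j hj => ?_) (colSpan_pickCols_le fun j hj => ?_)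
      · rw [← hbi]
        exact ha (Fin.lt_def.2 (by simp; omega))
      · rw [← hbi]
        exact ha.monotone (Fin.le_def.2 (by simp; omega))
    change Module.finrank ℝ (spanUpTo v (a i)) = _
    rw [h1]
    exact finrank_colSpan (isUnit_iff_ne_zero.2 hdet) (by omega)
  · intro k hk
    by_contra hlt
    have h2 : spanUpTo v k ≤ colSpan (pickCols v b) ((i : ℕ) + 1) := hle _ _ fun j hj => by
      refine (not_le.1 hlt).trans_le ?_
      rw [← hbi]
      exact ha.monotone (Fin.le_def.2 (by simpa using hj))
    have h3 := Submodule.finrank_mono h2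
    rw [finrank_colSpan (isUnit_iff_ne_zero.2 hdet) (by omega)] at h3
    change Module.finrank ℝ (spanUpTo v k) = _ at hk
    omega

/-- Before order `b j` the span has dimension at most `j`, and at `b j` it has dimension `j + 1`. So
each chosen vector is new, and the first `j` chosen ones span everything of order below `b j`. -/
theorem cramer_of_finrank_spanUpTo {v : ℕ → Vec n} {a : Fin (n + 1) → ℕ}
    (ha : StrictMono (Fin.cons 0 a : Fin (n + 2) → ℕ)) (hv : v 0 ≠ 0)
    (h : ∀ i : Fin (n + 1), IsLeast {k | Module.finrank ℝ (spanUpTo v k) = (i : ℕ) + 2} (a i)) :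
    (pickCols v (Fin.cons 0 a)).det ≠ 0 ∧
      ∀ (j : Fin (n + 2)) (c : ℕ), c < (Fin.cons 0 a : Fin (n + 2) → ℕ) j →
        (pickCols v (Fin.cons 0 a)).cramer (v c) j = 0 := by
  set b : Fin (n + 2) → ℕ := Fin.cons 0 a with hb
  have hat : ∀ j, Module.finrank ℝ (spanUpTo v (b j)) = (j : ℕ) + 1 := by
    intro j
    refine Fin.cases ?_ (fun i => ?_) j
    · have h0 : spanUpTo v (b 0) = Submodule.span ℝ {v 0} := by
        refine le_antisymm (spanUpTo_le fun i hi => ?_) ?_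
        · have : i = 0 := by simpa [hb] using hi
          subst this
          exact Submodule.mem_span_singleton_self _
        · rw [Submodule.span_singleton_le_iff_mem]
          exact mem_spanUpTo v (Nat.zero_le _)
      rw [h0, finrank_span_singleton hv]
      simp
    · exact (h i).1
  have hlt : ∀ j c, c < b j → Module.finrank ℝ (spanUpTo v c) ≤ (j : ℕ) := by
    intro j
    refine Fin.cases (fun c hc => ?_) (fun i c hc => ?_) j
    · simp [hb] at hc
    · have h1 := Submodule.finrank_mono (spanUpTo_mono v hc.le)
      rw [hat] at h1
      have h2 : Module.finrank ℝ (spanUpTo v c) ≠ (i : ℕ) + 2 := fun h2 => by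
        have := (h i).2 h2
        simp [hb] at hc
        omega
      simp at h1 ⊢
      omega
  have hdet : (pickCols v b).det ≠ 0 := by
    intro h0
    obtain ⟨e, he, hBe⟩ := Matrix.exists_mulVec_eq_zero_iff.2 h0
    -- The last nonzero coefficient of a linear relation would place `v (b j)` in the span of
    -- earlier vectors, against the dimension jump.
    obtain ⟨j, hj, hmax⟩ : ∃ j, e j ≠ 0 ∧ ∀ i, j < i → e i = 0 := by
      obtain ⟨i, hi⟩ := Function.ne_iff.1 he
      obtain ⟨j, hj, hm⟩ := (Finset.univ.filter fun i => e i ≠ 0).exists_max_image id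
        ⟨i, by simpa using hi⟩
      refine ⟨j, by simpa using hj, fun i hi => ?_⟩
      by_contra hne
      exact absurd (hm i (by simpa using hne)) (not_le.2 hi)
    have hsum : ∑ i, e i • v (b i) = 0 := by
      rw [← hBe]
      funext l
      simp [Matrix.mulVec, dotProduct, pickCols, mul_comm]
    have hsum2 : ∑ i ∈ Finset.univ.erase j, e i • v (b i) + e j • v (b j) = 0 := by
      rw [Finset.sum_erase_add _ _ (Finset.mem_univ j), hsum]
    have hpos : j ≠ 0 := by
      rintro rfl
      have : ∑ i ∈ Finset.univ.erase (0 : Fin (n + 2)), e i • v (b i) = 0 := by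
        refine Finset.sum_eq_zero fun i hi => ?_
        rw [hmax i (Fin.pos_iff_ne_zero.2 (by simpa using hi)), zero_smul]
      rw [this, zero_add] at hsum2
      rcases smul_eq_zero.1 hsum2 with h1 | h1
      · exact hj h1
      · exact hv (by simpa [hb] using h1)
    have hbj : 0 < b j := by
      have := ha (Fin.pos_iff_ne_zero.2 hpos)
      simp [hb] at this
      exact this
    have hmem : v (b j) ∈ spanUpTo v (b j - 1) := by
      have h1 : e j • v (b j) ∈ spanUpTo v (b j - 1) := by
        rw [← neg_eq_of_add_eq_zero_right hsum2]
        refine Submodule.neg_mem _ (Submodule.sum_mem _ fun i hi => ?_)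
        rcases lt_trichotomy i j with hij | hij | hij
        · exact Submodule.smul_mem _ _ (mem_spanUpTo v (by have := ha hij; omega))
        · exact absurd hij (by simpa using hi)
        · rw [hmax i hij, zero_smul]
          exact Submodule.zero_mem _
      exact (Submodule.smul_mem_iff _ hj).1 h1
    have hle : spanUpTo v (b j) ≤ spanUpTo v (b j - 1) := spanUpTo_le fun i hi => by
      rcases hi.lt_or_eq with hi | rfl
      · exact mem_spanUpTo v (by omega)
      · exact hmem
    have h1 := Submodule.finrank_mono hle
    have h2 := hlt j (b j - 1) (by omega)
    rw [hat] at h1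
    omega
  refine ⟨hdet, fun j c hc => ?_⟩
  have hle : colSpan (pickCols v b) (j : ℕ) ≤ spanUpTo v (b j - 1) :=
    colSpan_pickCols_le fun i hi => by
      have := ha (Fin.lt_def.2 hi)
      omega
  have heq := Submodule.eq_of_le_of_finrank_le hle (by
    rw [finrank_colSpan (isUnit_iff_ne_zero.2 hdet) (by omega)]
    exact hlt j _ (by omega))
  have hmem : v c ∈ colSpan (pickCols v b) (j : ℕ) := by
    rw [heq]
    exact mem_spanUpTo v (by omega)
  exact (mem_colSpan_iff_cramer hdet _ _).1 hmem j le_rfl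

theorem strictMono_cons_zero {a : Fin (n + 1) → ℕ} (ha : StrictMono a) (ha₁ : 1 ≤ a 0) :
    StrictMono (Fin.cons 0 a : Fin (n + 2) → ℕ) := by
  rw [Fin.strictMono_iff_lt_succ]
  intro i
  refine Fin.cases ?_ (fun i => ?_) i
  · simpa using Nat.pos_of_ne_zero (Nat.one_le_iff_ne_zero.1 ha₁)
  · rw [← Fin.succ_castSucc]
    simpa using ha (Fin.castSucc_lt_succ)

theorem isOfType_iff_cramer {γ : ℝ → Vec n} {t : ℝ} {a : Fin (n + 1) → ℕ} {v : ℕ → Vec n}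
    (ha : StrictMono a) (ha₁ : 1 ≤ a 0) (g : GL (Fin (n + 2)) ℝ)
    (hv : ∀ k, iteratedDeriv k γ t = (g : Mat n).mulVec (v k)) (hv0 : v 0 ≠ 0) :
    IsOfType γ t a ↔ (pickCols v (Fin.cons 0 a)).det ≠ 0 ∧
      ∀ (j : Fin (n + 2)) (c : ℕ), c < (Fin.cons 0 a : Fin (n + 2) → ℕ) j →
        (pickCols v (Fin.cons 0 a)).cramer (v c) j = 0 := by
  have hrank : ∀ k, (derivMatrix γ t k).rank = Module.finrank ℝ (spanUpTo v k) := by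
    intro k
    have h1 : derivMatrix γ t k =
        (g : Mat n) * (Matrix.of fun i (j : Fin (k + 1)) => v j i) := by
      ext i j
      rw [derivMatrix, Matrix.of_apply, hv]
      rfl
    rw [h1, Matrix.rank_mul_eq_right_of_isUnit_det _ _
      ((Matrix.isUnit_iff_isUnit_det _).1 g.isUnit), Matrix.rank_eq_finrank_span_cols]
    rfl
  have hs := strictMono_cons_zero ha ha₁
  simp only [IsOfType, hrank]
  exact ⟨cramer_of_finrank_spanUpTo hs hv0, fun h => finrank_spanUpTo_of_cramer hs h.1 h.2⟩

end Types

/-! ### Contact equations and type equations on jets -/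

section JetEquations

variable {n r : ℕ}

/-- The derivative of order `k` recorded in a jet of order `r`, and `0` for `k > r`. -/
def jetAt (w : Fin (r + 1) → Coord n) (k : ℕ) : Coord n := if h : k < r + 1 then w ⟨k, h⟩ else 0

theorem jetAt_of_lt (w : Fin (r + 1) → Coord n) {k : ℕ} (h : k < r + 1) :
    jetAt w k = w ⟨k, h⟩ := dif_pos h

theorem jetAt_add_smul (w δ : Fin (r + 1) → Coord n) (s : ℝ) (k : ℕ) (p) :
    jetAt (w + s • δ) k p = jetAt w k p + s * jetAt δ k p := by
  by_cases h : k < r + 1 <;> simp [jetAt, h]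

theorem contDiff_jetAt (k : ℕ) (p) : ContDiff ℝ ∞ fun x : JetCoord n r => jetAt x.2 k p := by
  by_cases h : k < r + 1
  · simp only [jetAt_of_lt _ h]
    fun_prop
  · simp only [jetAt, h, dif_neg, not_false_eq_true, Pi.zero_apply]
    exact contDiff_const

/-- The derivative of order `k` of the contact form `dx_{n+1} + ∑ y_j dx_j` along a curve in terms
of its jet, where `x_j` and `y_j` are the coordinates with indices `lineIdx` and `dualIdx`. -/
def contactEq (w : Fin (r + 1) → Coord n) (k : ℕ) : ℝ :=
  jetAt w (k + 1) (lineIdx (Fin.last n)) + ∑ j : Fin n, ∑ i ∈ Finset.range (k + 1),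
    (k.choose i : ℝ) * jetAt w i (dualIdx j) * jetAt w (k - i + 1) (lineIdx j.castSucc)

/-- The differential of `contactEq`. -/
def contactLin (w δ : Fin (r + 1) → Coord n) (k : ℕ) : ℝ :=
  jetAt δ (k + 1) (lineIdx (Fin.last n)) + ∑ j : Fin n, ∑ i ∈ Finset.range (k + 1),
    ((k.choose i : ℝ) * jetAt δ i (dualIdx j) * jetAt w (k - i + 1) (lineIdx j.castSucc) +
      (k.choose i : ℝ) * jetAt w i (dualIdx j) * jetAt δ (k - i + 1) (lineIdx j.castSucc))

theorem contDiff_contactEq (k : ℕ) : ContDiff ℝ ∞ fun x : JetCoord n r => contactEq x.2 k := by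
  unfold contactEq
  refine (contDiff_jetAt _ _).add (ContDiff.sum fun j _ => ContDiff.sum fun i _ => ?_)
  exact (contDiff_const.mul (contDiff_jetAt _ _)).mul (contDiff_jetAt _ _)

theorem hasDerivAt_jetAt (w δ : Fin (r + 1) → Coord n) (k : ℕ) (p) :
    HasDerivAt (fun s : ℝ => jetAt (w + s • δ) k p) (jetAt δ k p) 0 := by
  simp only [jetAt_add_smul]
  simpa using ((hasDerivAt_id (0 : ℝ)).mul_const (jetAt δ k p)).const_add (jetAt w k p)

theorem hasDerivAt_contactEq (w δ : Fin (r + 1) → Coord n) (k : ℕ) :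
    HasDerivAt (fun s : ℝ => contactEq (w + s • δ) k) (contactLin w δ k) 0 := by
  unfold contactEq contactLin
  refine (hasDerivAt_jetAt _ _ _ _).add
    (HasDerivAt.fun_sum fun j _ => HasDerivAt.fun_sum fun i _ => ?_)
  have h := ((hasDerivAt_jetAt w δ i (dualIdx j)).const_mul (k.choose i : ℝ)).fun_mul
    (hasDerivAt_jetAt w δ (k - i + 1) (lineIdx j.castSucc))
  simpa using h

/-- Every product in `contactEq` contains a derivative of some `x_j`, `j ≤ n`, of order between `1`
and `k + 1`. This redundancy is the source of the correction `a_1 - 1`. -/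
theorem jetAt_last_eq_zero {w : Fin (r + 1) → Coord n} {k : ℕ} (h : contactEq w k = 0)
    (h0 : ∀ c, 1 ≤ c → c ≤ k + 1 → ∀ j : Fin n, jetAt w c (lineIdx j.castSucc) = 0) :
    jetAt w (k + 1) (lineIdx (Fin.last n)) = 0 := by
  rw [contactEq, Finset.sum_eq_zero, add_zero] at h
  · exact h
  · intro j _
    refine Finset.sum_eq_zero fun i hi => ?_
    rw [h0 (k - i + 1) (by omega) (by omega), mul_zero]

theorem exists_coord (A : Fin (n + 1) → ℝ) (C : Fin n → ℝ) :
    ∃ y : Coord n, (∀ i, y (lineIdx i) = A i) ∧ ∀ j, y (dualIdx j) = C j := by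
  have hinj : Function.Injective (Sum.elim (lineIdx (n := n)) dualIdx) :=
    lineIdx_injective.sumElim dualIdx_injective lineIdx_ne_dualIdx
  exact ⟨Function.extend (Sum.elim lineIdx dualIdx) (Sum.elim A C) 0,
    fun i => hinj.extend_apply _ _ (Sum.inl i), fun j => hinj.extend_apply _ _ (Sum.inr j)⟩

/-- The jet coordinates with parameter in `T` that satisfy the contact equations. -/
def contactSet (n r : ℕ) (T : Set ℝ) : Set (JetCoord n r) :=
  {x | x.1 ∈ T ∧ ∀ k < r, contactEq x.2 k = 0}

/-- Equation `k` contains `x_{n+1}^{(k+1)}` with coefficient `1`, and no other derivative of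
`x_{n+1}`. -/
theorem isSubmanifoldOfCodim_contactSet {T : Set ℝ} (hT : IsOpen T) :
    IsSubmanifoldOfCodim (contactSet n r T) r := by
  have key : IsSubmanifoldOfCodim (contactSet n r T) (Fintype.card (Fin r)) := by
    refine isSubmanifoldOfCodim_of_equations fun x hx => ⟨{y | y.1 ∈ T},
      fun y k => contactEq y.2 (k : ℕ), hT.preimage continuous_fst, hx.1,
      contDiff_pi.2 fun k => contDiff_contactEq _, ?_, ?_⟩
    · refine surjective_fderiv_of_hasDerivAt_line
        ((contDiff_pi.2 fun k : Fin r => contDiff_contactEq (k : ℕ)).differentiable (by simp) x) ?_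
      intro η
      -- Only `x_{n+1}` is varied, its order `c` serving equation `c - 1`. The truncated value at `c
      -- = 0` is harmless: order `0` of `x_{n+1}` enters no equation.
      choose Y hY hY' using fun c : Fin (r + 1) => exists_coord (n := n)
        (fun i => if i = Fin.last n then (if h : (c : ℕ) - 1 < r then η ⟨(c : ℕ) - 1, h⟩ else 0)
          else 0) 0
      refine ⟨(0, Y), hasDerivAt_pi.2 fun k => ?_⟩
      have h1 := hasDerivAt_contactEq x.2 Y (k : ℕ)
      have h2 : contactLin x.2 Y (k : ℕ) = η k := by
        rw [contactLin, Finset.sum_eq_zero, add_zero, jetAt_of_lt _ (by omega), hY]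
        · simp
        · intro j _
          refine Finset.sum_eq_zero fun i hi => ?_
          have hik : i < (k : ℕ) + 1 := by simpa using hi
          rw [jetAt_of_lt Y (k := i) (by omega), hY', jetAt_of_lt Y (k := (k : ℕ) - i + 1) (by omega),
            hY, if_neg (Fin.castSucc_lt_last j).ne]
          simp
      rw [h2] at h1
      exact h1
    · ext y
      simp only [contactSet, Set.mem_inter_iff, Set.mem_ofPred_eq, funext_iff, Pi.zero_apply,
        Fin.forall_iff]
      tauto
  simpa using key

/-- The derivatives of `(1, x_1, …, x_{n+1})` in terms of jets. -/
def lineJet (w : Fin (r + 1) → Coord n) (k : ℕ) : Vec n :=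
  Fin.cons (if k = 0 then 1 else 0) fun i => jetAt w k (lineIdx i)

theorem lineJet_zero (w : Fin (r + 1) → Coord n) (k : ℕ) :
    lineJet w k 0 = if k = 0 then 1 else 0 := rfl

theorem lineJet_succ (w : Fin (r + 1) → Coord n) (k : ℕ) (i : Fin (n + 1)) :
    lineJet w k i.succ = jetAt w k (lineIdx i) := rfl

theorem contDiff_lineJet (k : ℕ) (i : Fin (n + 2)) :
    ContDiff ℝ ∞ fun x : JetCoord n r => lineJet x.2 k i := by
  refine Fin.cases ?_ (fun i => ?_) i
  · exact contDiff_const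
  · exact contDiff_jetAt _ _

theorem lineJet_eq_zero {w : Fin (r + 1) → Coord n} {k : ℕ} (hk : 1 ≤ k)
    (h : contactEq w (k - 1) = 0)
    (h0 : ∀ c, 1 ≤ c → c ≤ k → ∀ j : Fin n, jetAt w c (lineIdx j.castSucc) = 0) :
    lineJet w k = 0 := by
  obtain ⟨m, rfl⟩ : ∃ m, k = m + 1 := ⟨k - 1, by omega⟩
  funext i
  refine Fin.cases ?_ (fun i => ?_) i
  · simp [lineJet_zero]
  · rw [lineJet_succ]
    refine Fin.lastCases ?_ (fun j => ?_) i
    · exact jetAt_last_eq_zero h h0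
    · exact h0 _ hk le_rfl j

/-- The jet `w` of a curve is such that the curve of lines is of type `a`. -/
def JetHasType (w : Fin (r + 1) → Coord n) (a : Fin (n + 1) → ℕ) : Prop :=
  (pickCols (lineJet w) (Fin.cons 0 a)).det ≠ 0 ∧
    ∀ (j : Fin (n + 2)) (c : ℕ), c < (Fin.cons 0 a : Fin (n + 2) → ℕ) j →
      (pickCols (lineJet w) (Fin.cons 0 a)).cramer (lineJet w c) j = 0

/-- The part of `contactSet` where the type is `a`. -/
def contactTypeSet (n r : ℕ) (T : Set ℝ) (a : Fin (n + 1) → ℕ) : Set (JetCoord n r) :=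
  {x | x.1 ∈ T ∧ (∀ k < r, contactEq x.2 k = 0) ∧ JetHasType x.2 a}

/-- The equations, besides the contact equations, for type `a`: one for each `j` and each order
`c < a_{j+1}` that is not one of the `a_i`. -/
abbrev TypeEqIdx (r : ℕ) (a : Fin (n + 1) → ℕ) : Type :=
  {q : Fin n × Fin (r + 1) // 1 ≤ (q.2 : ℕ) ∧ (q.2 : ℕ) < a q.1.succ ∧ ∀ i, a i ≠ (q.2 : ℕ)}

/-- The equations for type `a` on the open set where the derivatives of orders `0` and `a_i` are
linearly independent. -/
def typeEq (a : Fin (n + 1) → ℕ) (w : Fin (r + 1) → Coord n) (q : TypeEqIdx r a) : ℝ :=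
  if (q.1.2 : ℕ) < a 0 then jetAt w q.1.2 (lineIdx q.1.1.castSucc)
  else (pickCols (lineJet w) (Fin.cons 0 a)).cramer (lineJet w q.1.2) q.1.1.succ.succ

theorem contDiff_typeEq (a : Fin (n + 1) → ℕ) (q : TypeEqIdx r a) :
    ContDiff ℝ ∞ fun x : JetCoord n r => typeEq a x.2 q := by
  unfold typeEq
  split_ifs
  · exact contDiff_jetAt _ _
  · simp only [Matrix.cramer_apply]
    refine contDiff_matrix_det fun i j => ?_
    simp only [Matrix.updateCol_apply]
    split_ifs
    · exact contDiff_lineJet _ _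
    · exact contDiff_lineJet _ _

/-- Only the coordinate along the derivative of order `0` can survive. That vector has first entry
`1`, while every derivative of positive order has first entry `0`. -/
theorem JetHasType.lineJet_eq_zero {w : Fin (r + 1) → Coord n} {a : Fin (n + 1) → ℕ}
    (ha : StrictMono a) (h : JetHasType w a) {c : ℕ} (hc : 1 ≤ c) (hca : c < a 0) :
    lineJet w c = 0 := by
  obtain ⟨hdet, hcr⟩ := h
  have h1 : (pickCols (lineJet w) (Fin.cons 0 a)).cramer (lineJet w c) =
      Pi.single 0 ((pickCols (lineJet w) (Fin.cons 0 a)).cramer (lineJet w c) 0) := by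
    funext j
    refine Fin.cases ?_ (fun i => ?_) j
    · simp
    · rw [Pi.single_eq_of_ne (Fin.succ_ne_zero i)]
      refine hcr _ _ ?_
      rw [Fin.cons_succ]
      exact hca.trans_le (ha.monotone (Fin.zero_le i))
  have h2 := Matrix.mulVec_cramer (pickCols (lineJet w) (Fin.cons 0 a)) (lineJet w c)
  rw [h1, Matrix.mulVec_single] at h2
  have h3 := congrFun h2 0
  have h4 : (pickCols (lineJet w) (Fin.cons 0 a)).cramer (lineJet w c) 0 = 0 := by
    simpa [pickCols, lineJet_zero, Nat.one_le_iff_ne_zero.1 hc] using h3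
  rw [h4] at h2
  have h5 : (pickCols (lineJet w) (Fin.cons 0 a)).det • lineJet w c = 0 := by
    rw [← h2]
    simp
  exact (smul_eq_zero.1 h5).resolve_left hdet

theorem cramer_col_of_ne (v : ℕ → Vec n) (b : Fin (n + 2) → ℕ) {i j : Fin (n + 2)} (h : j ≠ i) :
    (pickCols v b).cramer (v (b i)) j = 0 := by
  have : v (b i) = (pickCols v b).mulVec (Pi.single i 1) := by
    rw [Matrix.mulVec_single_one]
    rfl
  rw [this, cramer_mulVec, Pi.smul_apply, Pi.single_eq_of_ne h, smul_zero]

/-- The conditions absent from `typeEq` are automatic: orders `0` and `a_i` are columns of the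
basis, and below `a_1` the contact equations supply the missing derivative of `x_{n+1}`. -/
theorem jetHasType_iff {w : Fin (r + 1) → Coord n} {a : Fin (n + 1) → ℕ} (ha : StrictMono a)
    (hr : a (Fin.last n) ≤ r) (hw : ∀ k < r, contactEq w k = 0)
    (hdet : (pickCols (lineJet w) (Fin.cons 0 a)).det ≠ 0) :
    JetHasType w a ↔ ∀ q, typeEq a w q = 0 := by
  have har : ∀ i, a i ≤ r := fun i => (ha.monotone (Fin.le_last i)).trans hr
  constructor
  · rintro h ⟨⟨j, c⟩, hc1, hc2, hc3⟩
    unfold typeEq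
    split_ifs with hlt
    · have := h.lineJet_eq_zero ha hc1 hlt
      rw [← lineJet_succ, this, Pi.zero_apply]
    · exact h.2 _ _ (by simpa using hc2)
  · intro h
    have hzero : ∀ c, 1 ≤ c → c < a 0 → lineJet w c = 0 := by
      intro c hc hca
      refine FlagJet.lineJet_eq_zero hc (hw _ (by have := har 0; omega)) fun d hd hdc j => ?_
      have hda : d < a 0 := by omega
      have hall : ∀ i, d < a i := fun i => hda.trans_le (ha.monotone (Fin.zero_le i))
      have := h ⟨(j, ⟨d, by have := har 0; omega⟩), hd, hall _, fun i => (hall i).ne'⟩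
      rwa [typeEq, if_pos hda] at this
    refine ⟨hdet, fun j c hc => ?_⟩
    by_cases hrange : ∃ i, (Fin.cons 0 a : Fin (n + 2) → ℕ) i = c
    · obtain ⟨i, rfl⟩ := hrange
      refine cramer_col_of_ne _ _ ?_
      rintro rfl
      exact lt_irrefl _ hc
    · push Not at hrange
      have hc1 : 1 ≤ c := Nat.one_le_iff_ne_zero.2 fun h0 => hrange 0 (by simp [h0])
      by_cases hca : c < a 0
      · rw [hzero c hc1 hca, map_zero, Pi.zero_apply]
      · revert hc
        refine Fin.cases (fun hc => ?_) (fun i => ?_) j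
        · simp at hc
        · refine Fin.cases (fun hc => ?_) (fun i hc => ?_) i
          · exact absurd hc hca
          · have hc' : c < a i.succ := hc
            have := h ⟨(i, ⟨c, by have := har i.succ; omega⟩), hc1, hc', fun i => hrange i.succ⟩
            rwa [typeEq, if_neg hca] at this

/-- The solution of a triangular system of linear equations. -/
noncomputable def triangularSolution (A : ℕ → ℕ → ℝ) (b : ℕ → ℝ) (m : ℕ) : ℝ :=
  (b m - ∑ i : Fin m, A m i * triangularSolution A b i) / A m m
decreasing_by exact i.2

theorem sum_triangularSolution (A : ℕ → ℕ → ℝ) (b : ℕ → ℝ) {m : ℕ} (h : A m m ≠ 0) :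
    ∑ i ∈ Finset.range (m + 1), A m i * triangularSolution A b i = b m := by
  rw [Finset.sum_range_succ, triangularSolution.eq_def A b m, mul_div_cancel₀ _ h,
    ← Fin.sum_univ_eq_sum_range (fun i => A m i * triangularSolution A b i)]
  ring

end JetEquations

/-! ### Transversality and the count of the equations -/

section TypeSubmanifold

variable {n r : ℕ}

/-- If `x_1, …, x_n` had vanishing derivatives of order `a_1`, the contact equations would give
`x_{n+1}` one too, and a column of the basis would be zero. -/
theorem sum_sq_ne_zero {w : Fin (r + 1) → Coord n} {a : Fin (n + 1) → ℕ} (ha : StrictMono a)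
    (ha₁ : 1 ≤ a 0) (hr : a (Fin.last n) ≤ r) (hw : ∀ k < r, contactEq w k = 0)
    (h : JetHasType w a) :
    ∑ j : Fin n, jetAt w (a 0) (lineIdx j.castSucc) * jetAt w (a 0) (lineIdx j.castSucc) ≠ 0 := by
  intro h0
  have har : a 0 ≤ r := (ha.monotone (Fin.le_last 0)).trans hr
  have hz : ∀ j : Fin n, jetAt w (a 0) (lineIdx j.castSucc) = 0 := fun j => by
    have := (Finset.sum_eq_zero_iff_of_nonneg fun j _ => mul_self_nonneg _).1 h0 j
      (Finset.mem_univ j)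
    exact mul_self_eq_zero.1 this
  have hl : lineJet w (a 0) = 0 := by
    refine lineJet_eq_zero ha₁ (hw _ (by omega)) fun c hc hca j => ?_
    rcases hca.lt_or_eq with hlt | rfl
    · rw [← lineJet_succ, h.lineJet_eq_zero ha hc hlt, Pi.zero_apply]
    · exact hz j
  refine h.1 (Matrix.det_eq_zero_of_column_eq_zero (Fin.succ 0) fun i => ?_)
  simp only [pickCols, Matrix.of_apply, Fin.cons_succ, hl, Pi.zero_apply]

/-- The linearised contact equations can be solved with all variations of the `x_i` prescribed,
except those of `x_{n+1}` of orders `1, …, m₀ - 1`. These exceptions solve the equations with `k + 1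
< m₀`. For the others, the `y_j` are varied by `q i` times the vector of the `x_j^{(m₀)}`: the
unknowns `q i` satisfy a triangular system with diagonal entries a binomial coefficient times the
squared length of that vector. -/
theorem exists_contactLin_eq {w : Fin (r + 1) → Coord n} {m₀ : ℕ} (hm₀ : 1 ≤ m₀)
    (hzero : ∀ c, 1 ≤ c → c < m₀ → ∀ j : Fin n, jetAt w c (lineIdx j.castSucc) = 0)
    (hz : ∑ j : Fin n, jetAt w m₀ (lineIdx j.castSucc) * jetAt w m₀ (lineIdx j.castSucc) ≠ 0)
    (φ : ℕ → ℝ) (d : ℕ → Fin (n + 1) → ℝ) :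
    ∃ δ : Fin (r + 1) → Coord n, (∀ k < r, contactLin w δ k = φ k) ∧
      (∀ c ≤ r, ∀ j : Fin n, jetAt δ c (lineIdx j.castSucc) = d c j.castSucc) ∧
      (∀ c ≤ r, c = 0 ∨ m₀ ≤ c → jetAt δ c (lineIdx (Fin.last n)) = d c (Fin.last n)) := by
  -- `known` is the contribution of the prescribed variations of `x_1, …, x_n`, `quad` that of the
  -- variations of the `y_j`. Row `m` of `A` belongs to the equation of order `m + m₀ - 1`.
  let known : ℕ → ℝ := fun k => ∑ j : Fin n, ∑ i ∈ Finset.range (k + 1),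
    (k.choose i : ℝ) * jetAt w i (dualIdx j) * d (k - i + 1) j.castSucc
  let A : ℕ → ℕ → ℝ := fun m i => ((m + m₀ - 1).choose i : ℝ) *
    ∑ j : Fin n, jetAt w m₀ (lineIdx j.castSucc) * jetAt w (m + m₀ - 1 - i + 1) (lineIdx j.castSucc)
  let q : ℕ → ℝ := triangularSolution A fun m =>
    φ (m + m₀ - 1) - d (m + m₀) (Fin.last n) - known (m + m₀ - 1)
  have hAm : ∀ m, A m m ≠ 0 := by
    intro m
    have e : m + m₀ - 1 - m + 1 = m₀ := by omega
    simp only [A, e]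
    exact mul_ne_zero (Nat.cast_ne_zero.2 (Nat.choose_pos (by omega)).ne') hz
  let quad : ℕ → ℝ := fun k => ∑ j : Fin n, ∑ i ∈ Finset.range (k + 1),
    (k.choose i : ℝ) * (q i * jetAt w m₀ (lineIdx j.castSucc)) *
      jetAt w (k - i + 1) (lineIdx j.castSucc)
  have hquad : ∀ k, m₀ ≤ k + 1 → quad k = φ k - d (k + 1) (Fin.last n) - known k := by
    intro k hk
    obtain ⟨m, rfl⟩ : ∃ m, k = m + m₀ - 1 := ⟨k + 1 - m₀, by omega⟩
    have e1 : m + m₀ - 1 + 1 = m + m₀ := by omega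
    have h1 := sum_triangularSolution A (fun m =>
      φ (m + m₀ - 1) - d (m + m₀) (Fin.last n) - known (m + m₀ - 1)) (hAm m)
    rw [e1, ← h1]
    simp only [quad]
    rw [Finset.sum_comm, e1]
    -- Terms with `i > m` contain derivatives of `x_j` of orders between `1` and `m₀ - 1`, which
    -- vanish; this is the triangularity.
    have hsub : Finset.range (m + 1) ⊆ Finset.range (m + m₀) :=
      Finset.range_subset_range.2 (by omega)
    rw [← Finset.sum_subset hsub]
    · refine Finset.sum_congr rfl fun i _ => ?_
      simp only [A]
      rw [Finset.mul_sum, Finset.sum_mul]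
      refine Finset.sum_congr rfl fun j _ => ?_
      change _ = _ * q i
      ring
    · intro i hi hi'
      rw [Finset.mem_range] at hi hi'
      refine Finset.sum_eq_zero fun j _ => ?_
      rw [hzero (m + m₀ - 1 - i + 1) (by omega) (by omega), mul_zero]
  choose Y hY hY' using fun c : Fin (r + 1) => exists_coord (n := n)
    (fun i => if i = Fin.last n ∧ 1 ≤ (c : ℕ) ∧ (c : ℕ) < m₀ then
      φ ((c : ℕ) - 1) - quad ((c : ℕ) - 1) - known ((c : ℕ) - 1) else d c i)
    (fun j => q c * jetAt w m₀ (lineIdx j.castSucc))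
  have hfree : ∀ c ≤ r, ∀ j : Fin n, jetAt Y c (lineIdx j.castSucc) = d c j.castSucc := by
    intro c hc j
    rw [jetAt_of_lt Y (by omega), hY, if_neg fun h => (Fin.castSucc_lt_last j).ne h.1]
  have hdual : ∀ c ≤ r, ∀ j : Fin n,
      jetAt Y c (dualIdx j) = q c * jetAt w m₀ (lineIdx j.castSucc) := by
    intro c hc j
    rw [jetAt_of_lt Y (by omega), hY']
  have hlast : ∀ c ≤ r, c = 0 ∨ m₀ ≤ c →
      jetAt Y c (lineIdx (Fin.last n)) = d c (Fin.last n) := by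
    intro c hc h
    rw [jetAt_of_lt Y (by omega), hY, if_neg]
    rintro ⟨-, h1, h2⟩
    simp only at h1 h2
    omega
  refine ⟨Y, fun k hk => ?_, hfree, hlast⟩
  have hlin : contactLin w Y k = jetAt Y (k + 1) (lineIdx (Fin.last n)) + (quad k + known k) := by
    simp only [contactLin, quad, known, ← Finset.sum_add_distrib]
    congr 1
    refine Finset.sum_congr rfl fun j _ => Finset.sum_congr rfl fun i hi => ?_
    rw [Finset.mem_range] at hi
    rw [hdual i (by omega), hfree _ (by omega)]
  rw [hlin]
  by_cases hkm : k + 1 < m₀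
  · rw [jetAt_of_lt Y (by omega), hY, if_pos ⟨rfl, by simp, hkm⟩]
    simp only [Nat.add_sub_cancel]
    ring
  · rw [hlast _ (by omega) (Or.inr (by omega)), hquad k (by omega)]
    ring

theorem lineJet_add_smul {w δ : Fin (r + 1) → Coord n} {c : ℕ} {D : Vec n} (h0 : D 0 = 0)
    (hD : ∀ i, jetAt δ c (lineIdx i) = D (Fin.succ i)) (s : ℝ) :
    lineJet (w + s • δ) c = lineJet w c + s • D := by
  funext i
  refine Fin.cases ?_ (fun i => ?_) i
  · simp [lineJet_zero, h0]
  · simp [lineJet_succ, jetAt_add_smul, hD]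

/-- The variation fixes the basis columns, so along it each Cramer coordinate is affine and takes
any prescribed slope; `exists_contactLin_eq` then adjusts the contact equations. -/
theorem surjective_fderiv_contactTypeEq {a : Fin (n + 1) → ℕ} (ha : StrictMono a)
    (ha₁ : 1 ≤ a 0) (hr : a (Fin.last n) ≤ r) {x : JetCoord n r}
    (hw : ∀ k < r, contactEq x.2 k = 0) (hx : JetHasType x.2 a) :
    Function.Surjective (fderiv ℝ (fun (y : JetCoord n r) =>
      (Sum.elim (fun k : Fin r => contactEq y.2 (k : ℕ)) (typeEq a y.2) :
        Fin r ⊕ TypeEqIdx r a → ℝ)) x) := by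
  have har : ∀ i, a i ≤ r := fun i => (ha.monotone (Fin.le_last i)).trans hr
  have ha0 : ∀ i, a 0 ≤ a i := fun i => ha.monotone (Fin.zero_le i)
  refine surjective_fderiv_of_hasDerivAt_line ?_ fun η => ?_
  · refine ContDiff.differentiable (n := ∞) (contDiff_pi.2 ?_) (by simp) x
    rintro (k | q)
    · exact contDiff_contactEq _
    · exact contDiff_typeEq a q
  set w := x.2 with hwdef
  set B := pickCols (lineJet w) (Fin.cons 0 a) with hB
  let φ : ℕ → ℝ := fun k => if h : k < r then η (Sum.inl ⟨k, h⟩) else 0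
  let ηq : Fin n → ℕ → ℝ := fun j c =>
    if h : c < r + 1 ∧ 1 ≤ c ∧ c < a j.succ ∧ ∀ i, a i ≠ c then
      η (Sum.inr ⟨(j, ⟨c, h.1⟩), h.2⟩) else 0
  let H : ℕ → Vec n := fun c => Fin.cons 0 (Fin.cons 0 fun j => ηq j c)
  -- Below `a 0` the equations read the entries of `x_1, …, x_n` directly. From `a 0` on they read
  -- Cramer coordinates, and `cramer B (B H) = det B • H` explains the factor. The slots `0` and `1`
  -- of `H` are zero since they carry no equation.
  let D : ℕ → Vec n := fun c => if c < a 0 then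
      Fin.cons 0 (Fin.snoc (fun j => ηq j c) 0)
    else B.det⁻¹ • B.mulVec (H c)
  have hD0 : ∀ c, D c 0 = 0 := by
    intro c
    simp only [D]
    split_ifs
    · rfl
    · have : B.mulVec (H c) 0 = 0 := by
        change ∑ j, B 0 j * H c j = 0
        refine Finset.sum_eq_zero fun j _ => ?_
        refine Fin.cases ?_ (fun j => ?_) j
        · simp [H]
        · have : a j ≠ 0 := by have := ha0 j; omega
          simp [hB, pickCols, lineJet_zero, this]
      rw [Pi.smul_apply, this, smul_zero]
  have hηa : ∀ i j, ηq j (a i) = 0 := fun i j => dif_neg fun h => h.2.2.2 i rfl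
  have hη0 : ∀ j, ηq j 0 = 0 := fun j => dif_neg fun h => by omega
  have hDa : ∀ i, D ((Fin.cons 0 a : Fin (n + 2) → ℕ) i) = 0 := by
    intro i
    refine Fin.cases ?_ (fun i => ?_) i
    · funext j
      simp only [D, Fin.cons_zero]
      rw [if_pos (by omega)]
      refine Fin.cases rfl (fun j => ?_) j
      refine Fin.lastCases ?_ (fun j => ?_) j
      · simp
      · simp [hη0]
    · simp only [D, Fin.cons_succ]
      rw [if_neg (not_lt.2 (ha0 i))]
      have : H (a i) = 0 := by
        funext j
        refine Fin.cases rfl (fun j => ?_) j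
        refine Fin.cases rfl (fun j => ?_) j
        exact hηa i j
      rw [this, Matrix.mulVec_zero, smul_zero]
  obtain ⟨δ, hφ, hfree, hlast⟩ := exists_contactLin_eq ha₁
    (fun c hc hca j => by
      rw [← lineJet_succ, hx.lineJet_eq_zero ha hc hca, Pi.zero_apply])
    (sum_sq_ne_zero ha ha₁ hr hw hx) φ (fun c i => D c i.succ)
  have hline : ∀ c ≤ r, c = 0 ∨ a 0 ≤ c → ∀ s : ℝ,
      lineJet (w + s • δ) c = lineJet w c + s • D c := by
    intro c hc h s
    refine lineJet_add_smul (hD0 c) (fun i => ?_) s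
    refine Fin.lastCases ?_ (fun j => ?_) i
    · exact hlast c hc h
    · exact hfree c hc j
  -- The variation vanishes at orders `0` and `a i`, where `ηq` takes its default value `0`.
  have hcols : ∀ s : ℝ, pickCols (lineJet (w + s • δ)) (Fin.cons 0 a) = B := by
    intro s
    ext i j
    simp only [pickCols, Matrix.of_apply, hB]
    rw [hline, hDa, smul_zero, add_zero]
    · refine Fin.cases (Nat.zero_le _) (fun j => ?_) j
      exact har j
    · refine Fin.cases (Or.inl rfl) (fun j => ?_) j
      exact Or.inr (ha0 j)
  refine ⟨(0, δ), hasDerivAt_pi.2 ?_⟩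
  rintro (k | ⟨⟨j, c⟩, hq⟩)
  · have h1 := hasDerivAt_contactEq w δ (k : ℕ)
    rw [hφ k k.2] at h1
    simp only [φ, k.2, dif_pos] at h1
    exact h1
  · have hηqj : ηq j c = η (Sum.inr ⟨(j, c), hq⟩) := dif_pos ⟨c.2, hq⟩
    change HasDerivAt (fun s : ℝ => typeEq a (w + s • δ) ⟨(j, c), hq⟩) _ 0
    unfold typeEq
    by_cases hca : (c : ℕ) < a 0
    · simp only [hca, if_true]
      have h1 := hasDerivAt_jetAt w δ c (lineIdx j.castSucc)
      rw [hfree c (by omega)] at h1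
      simp only [D, hca, if_true, Fin.cons_succ, Fin.snoc_castSucc, hηqj] at h1
      exact h1
    · simp only [hca, if_false, hcols]
      have h1 : ∀ s : ℝ, B.cramer (lineJet (w + s • δ) c) j.succ.succ =
          B.cramer (lineJet w c) j.succ.succ + s * η (Sum.inr ⟨(j, c), hq⟩) := by
        intro s
        rw [hline c (by omega) (Or.inr (not_lt.1 hca)), map_add, map_smul, Pi.add_apply,
          Pi.smul_apply, smul_eq_mul]
        simp only [D, hca, if_false]
        rw [map_smul, cramer_mulVec, smul_smul, inv_mul_cancel₀ hx.1, one_smul]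
        simp only [H, Fin.cons_succ, hηqj]
      simp only [h1]
      simpa using ((hasDerivAt_id (0 : ℝ)).mul_const (η (Sum.inr ⟨(j, c), hq⟩))).const_add
        (B.cramer (lineJet w c) j.succ.succ)

theorem isSubmanifoldOfCodim_contactTypeSet {T : Set ℝ} (hT : IsOpen T) {a : Fin (n + 1) → ℕ}
    (ha : StrictMono a) (ha₁ : 1 ≤ a 0) (hr : a (Fin.last n) ≤ r) :
    IsSubmanifoldOfCodim (contactTypeSet n r T a) (r + Fintype.card (TypeEqIdx r a)) := by
  have key : IsSubmanifoldOfCodim (contactTypeSet n r T a)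
      (Fintype.card (Fin r ⊕ TypeEqIdx r a)) := by
    refine isSubmanifoldOfCodim_of_equations fun x hx =>
      ⟨{y | y.1 ∈ T} ∩ {y | (pickCols (lineJet y.2) (Fin.cons 0 a)).det ≠ 0},
      fun y => Sum.elim (fun k : Fin r => contactEq y.2 (k : ℕ)) (typeEq a y.2), ?_,
      ⟨hx.1, hx.2.2.1⟩, ?_, surjective_fderiv_contactTypeEq ha ha₁ hr hx.2.1 hx.2.2, ?_⟩
    · refine (hT.preimage continuous_fst).inter (isOpen_ne_fun ?_ continuous_const)
      exact (contDiff_matrix_det fun i j => contDiff_lineJet _ _).continuous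
    · refine contDiff_pi.2 ?_
      rintro (k | q)
      · exact contDiff_contactEq _
      · exact contDiff_typeEq a q
    · ext y
      simp only [contactTypeSet, Set.mem_inter_iff, Set.mem_ofPred_eq, funext_iff, Pi.zero_apply,
        Sum.forall, Sum.elim_inl, Sum.elim_inr, Fin.forall_iff]
      constructor
      · rintro ⟨⟨hT, hw, ht⟩, -, hdet⟩
        exact ⟨⟨hT, hdet⟩, hw, (jetHasType_iff ha hr hw hdet).1 ht⟩
      · rintro ⟨⟨hT, hdet⟩, hw, ht⟩
        exact ⟨⟨hT, hw, (jetHasType_iff ha hr hw hdet).2 ht⟩, hT, hdet⟩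
  simpa using key

/-- For each `j`, the orders are the `a j.succ - 1` positive integers below `a j.succ`, less the `j
+ 1` earlier values of `a`. -/
theorem card_typeEqIdx {a : Fin (n + 1) → ℕ} (ha : StrictMono a) (ha₁ : 1 ≤ a 0)
    (hr : a (Fin.last n) ≤ r) :
    (Fintype.card (TypeEqIdx r a) : ℤ) = ∑ i : Fin n, ((a i.succ : ℤ) - ((i : ℕ) + 2 : ℤ)) := by
  have har : ∀ i, a i ≤ r := fun i => (ha.monotone (Fin.le_last i)).trans hr
  have ha0 : ∀ i, a 0 ≤ a i := fun i => ha.monotone (Fin.zero_le i)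
  have hj : ∀ j : Fin n, ((Finset.univ.filter fun c : Fin (r + 1) =>
      1 ≤ (c : ℕ) ∧ (c : ℕ) < a j.succ ∧ ∀ i, a i ≠ (c : ℕ)).card : ℤ) =
        (a j.succ : ℤ) - ((j : ℕ) + 2 : ℤ) := by
    intro j
    have himg : ((Finset.univ.filter fun c : Fin (r + 1) =>
        1 ≤ (c : ℕ) ∧ (c : ℕ) < a j.succ ∧ ∀ i, a i ≠ (c : ℕ)).map Fin.valEmbedding) =
        Finset.Ico 1 (a j.succ) \ (Finset.Iio j.succ).image a := by
      ext c
      simp only [Finset.mem_map, Finset.mem_filter, Finset.mem_univ, true_and,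
        Fin.valEmbedding_apply, Finset.mem_sdiff, Finset.mem_Ico, Finset.mem_image,
        Finset.mem_Iio, not_exists, not_and]
      constructor
      · rintro ⟨c, ⟨h1, h2, h3⟩, rfl⟩
        exact ⟨⟨h1, h2⟩, fun i _ => h3 i⟩
      · rintro ⟨⟨h1, h2⟩, h3⟩
        refine ⟨⟨c, by have := har j.succ; omega⟩, ⟨h1, h2, fun i hi => ?_⟩, rfl⟩
        refine h3 i (ha.lt_iff_lt.1 ?_) hi
        rw [hi]
        exact h2
    rw [← Finset.card_map, himg, Finset.card_sdiff_of_subset,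
      Finset.card_image_of_injective _ ha.injective,
      Nat.card_Ico, Fin.card_Iio]
    · have h1 : ((Finset.Iio j.succ).image a).card ≤ (Finset.Ico 1 (a j.succ)).card := by
        refine Finset.card_le_card fun c hc => ?_
        simp only [Finset.mem_image, Finset.mem_Iio] at hc
        obtain ⟨i, hi, rfl⟩ := hc
        exact Finset.mem_Ico.2 ⟨ha₁.trans (ha0 i), ha hi⟩
      rw [Finset.card_image_of_injective _ ha.injective, Nat.card_Ico, Fin.card_Iio] at h1
      have h2 := ha₁.trans (ha0 j.succ)
      rw [Nat.cast_sub h1, Nat.cast_sub h2]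
      push_cast [Fin.val_succ]
      ring
    · intro c hc
      simp only [Finset.mem_image, Finset.mem_Iio] at hc
      obtain ⟨i, hi, rfl⟩ := hc
      exact Finset.mem_Ico.2 ⟨ha₁.trans (ha0 i), ha hi⟩
  rw [← Finset.sum_congr rfl fun j _ => hj j, Fintype.card_subtype, ← Nat.cast_sum]
  congr 1
  rw [Finset.card_filter, ← Finset.univ_product_univ, Finset.sum_product]
  refine Finset.sum_congr rfl fun j _ => ?_
  rw [Finset.card_filter]

end TypeSubmanifold

/-! ### From curves to jets and back -/

section JetsOfCurves

variable {n : ℕ}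

theorem iteratedDeriv_clm_comp {V V' : Type*} [NormedAddCommGroup V] [NormedSpace ℝ V]
    [NormedAddCommGroup V'] [NormedSpace ℝ V'] (L : V →L[ℝ] V') {f : ℝ → V} {s : ℝ}
    (hf : ContDiffAt ℝ ∞ f s) (k : ℕ) :
    iteratedDeriv k (fun t => L (f t)) s = L (iteratedDeriv k f s) := by
  rw [iteratedDeriv_eq_iteratedFDeriv, iteratedDeriv_eq_iteratedFDeriv]
  have := L.iteratedFDeriv_comp_left hf (i := k) (by exact_mod_cast le_top)
  rw [Function.comp_def] at this
  rw [this]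
  rfl

theorem iteratedDeriv_coord {v : ℝ → Coord n} {s : ℝ} (hv : ContDiffAt ℝ ∞ v s) (k : ℕ) (p) :
    iteratedDeriv k (fun t => v t p) s = iteratedDeriv k v s p :=
  iteratedDeriv_clm_comp (ContinuousLinearMap.proj (R := ℝ) (φ := fun _ => ℝ) p) hv k

/-- The `r`-jet of a curve in coordinates. -/
noncomputable def jetOf (r : ℕ) (v : ℝ → Coord n) (s : ℝ) : Fin (r + 1) → Coord n :=
  fun k => iteratedDeriv (k : ℕ) v s

theorem jetAt_jetOf {r : ℕ} (v : ℝ → Coord n) (s : ℝ) {k : ℕ} (hk : k ≤ r) :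
    jetAt (jetOf r v s) k = iteratedDeriv k v s := jetAt_of_lt _ (by omega)

/-- The contact form on straightened coordinates, evaluated on the velocity of a curve. -/
noncomputable def contactForm (v : ℝ → Coord n) (s : ℝ) : ℝ :=
  deriv (fun t => v t (lineIdx (Fin.last n))) s +
    ∑ j : Fin n, v s (dualIdx j) * deriv (fun t => v t (lineIdx j.castSucc)) s

theorem contactEq_jetOf {r : ℕ} {v : ℝ → Coord n} {s : ℝ} (hv : ContDiffAt ℝ ∞ v s) {k : ℕ}
    (hk : k < r) : contactEq (jetOf r v s) k = iteratedDeriv k (contactForm v) s := by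
  have hc : ∀ p, ContDiffAt ℝ ∞ (fun t => v t p) s := fun p => contDiffAt_pi.1 hv p
  have hd : ∀ p, ContDiffAt ℝ ∞ (deriv fun t => v t p) s := fun p => by
    have h := ((hc p).fderiv_right (m := ∞) (by simp)).clm_apply (contDiffAt_const (c := (1 : ℝ)))
    simpa only [fderiv_apply_one_eq_deriv] using h
  have hk' : ((k : ℕ∞) : WithTop ℕ∞) ≤ ∞ := by exact_mod_cast le_top
  have hterm : ∀ j : Fin n, iteratedDeriv k
      (fun t => v t (dualIdx j) * deriv (fun t => v t (lineIdx j.castSucc)) t) s =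
      ∑ i ∈ Finset.range (k + 1), (k.choose i : ℝ) * jetAt (jetOf r v s) i (dualIdx j) *
        jetAt (jetOf r v s) (k - i + 1) (lineIdx j.castSucc) := by
    intro j
    rw [iteratedDeriv_fun_mul ((hc _).of_le hk') ((hd _).of_le hk')]
    refine Finset.sum_congr rfl fun i hi => ?_
    rw [Finset.mem_range] at hi
    rw [jetAt_jetOf _ _ (by omega), jetAt_jetOf _ _ (by omega), ← iteratedDeriv_succ',
      iteratedDeriv_coord hv, iteratedDeriv_coord hv]
  unfold contactForm contactEq
  rw [iteratedDeriv_fun_add ((hd _).of_le hk')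
      (ContDiffAt.sum fun j _ => ((hc _).mul (hd _)).of_le hk'),
    iteratedDeriv_fun_sum fun j _ => ((hc _).mul (hd _)).of_le hk',
    ← iteratedDeriv_succ', iteratedDeriv_coord hv, jetAt_jetOf _ _ (by omega)]
  congr 1
  exact Finset.sum_congr rfl fun j _ => (hterm j).symm

theorem mem_pseudoContact_iff_contactForm (g : GL (Fin (n + 2)) ℝ) {u : ℝ → Coord n} {s : ℝ}
    (hu : DifferentiableAt ℝ u s) :
    deriv u s ∈ pseudoContact g (u s) ↔ contactForm (fun t => straighten (u t)) s = 0 := by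
  have hp : ∀ p, deriv (fun t => u t p) s = deriv u s p := fun p =>
    (hasDerivAt_pi.1 hu.hasDerivAt p).deriv
  rw [mem_pseudoContact_iff_straighten]
  simp only [contactForm, straighten_lineIdx, hp]

theorem isOfType_lineVec_iff {r : ℕ} {a : Fin (n + 1) → ℕ} (ha : StrictMono a) (ha₁ : 1 ≤ a 0)
    (hr : a (Fin.last n) ≤ r) (g : GL (Fin (n + 2)) ℝ) {u : ℝ → Coord n} {s : ℝ}
    (hu : ContDiffAt ℝ ∞ u s) :
    IsOfType (fun t => lineVec g (u t)) s a ↔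
      JetHasType (jetOf r (fun t => straighten (u t)) s) a := by
  have har : ∀ i, a i ≤ r := fun i => (ha.monotone (Fin.le_last i)).trans hr
  have hb : ∀ j, (Fin.cons 0 a : Fin (n + 2) → ℕ) j ≤ r := fun j =>
    Fin.cases (Nat.zero_le _) (fun i => har i) j
  let v : ℕ → Vec n := fun k => Fin.cons (if k = 0 then 1 else 0)
    fun i => iteratedDeriv k u s (lineIdx i)
  have hstr : ContDiffAt ℝ ∞ (fun t => straighten (u t)) s :=
    contDiff_straighten.contDiffAt.comp s hu
  -- Straightening does not change the `x_i`. The bound `k ≤ r` matters because `jetAt` is `0`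
  -- beyond order `r`; all orders in the type conditions are at most `a (Fin.last n)`.
  have hvl : ∀ k ≤ r, v k = lineJet (jetOf r (fun t => straighten (u t)) s) k := by
    intro k hk
    simp only [v, lineJet]
    congr 1
    funext i
    rw [jetAt_jetOf _ _ hk, ← iteratedDeriv_coord hu, ← iteratedDeriv_coord hstr]
    simp only [straighten_lineIdx]
  have hv : ∀ k, iteratedDeriv k (fun t => lineVec g (u t)) s = (g : Mat n).mulVec (v k) := by
    intro k
    have h1 : (fun t => lineVec g (u t)) = fun t => lineVecLinear g (u t) + lineVec g 0 :=
      funext fun t => lineVec_eq_add g (u t)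
    rcases Nat.eq_zero_or_pos k with rfl | hk
    · rw [iteratedDeriv_zero, lineVec_eq]
      simp [v]
    · have hadd : iteratedDeriv k (fun t => lineVecLinear g (u t) + lineVec g 0) s =
          iteratedDeriv k (fun t => lineVecLinear g (u t)) s := by
        simp only [add_comm _ (lineVec g 0)]
        exact iteratedDeriv_const_add hk _
      rw [h1, hadd, iteratedDeriv_clm_comp _ hu, lineVecLinear_apply]
      simp [v, hk.ne']
  have hv0 : v 0 ≠ 0 := fun h => by simpa [v] using congrFun h 0
  have hcols : pickCols v (Fin.cons 0 a) =
      pickCols (lineJet (jetOf r (fun t => straighten (u t)) s)) (Fin.cons 0 a) := by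
    ext i j
    simp only [pickCols, Matrix.of_apply, hvl _ (hb j)]
  rw [isOfType_iff_cramer ha ha₁ g hv hv0, hcols, JetHasType]
  refine and_congr_right fun _ => forall_congr' fun j => forall_congr' fun c =>
    forall_congr' fun hc => ?_
  rw [hvl c (hc.le.trans (hb j))]

theorem exists_antideriv {F : ℝ → ℝ} (hF : ContDiff ℝ ∞ F) (s₀ c : ℝ) :
    ∃ G : ℝ → ℝ, ContDiff ℝ ∞ G ∧ G s₀ = c ∧ ∀ s, deriv G s = F s := by
  have hd : ∀ s, HasDerivAt (fun s => c + ∫ t in s₀..s, F t) (F s) s := fun s =>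
    (hF.continuous.integral_hasStrictDerivAt s₀ s).hasDerivAt.const_add c
  refine ⟨fun s => c + ∫ t in s₀..s, F t, ?_, by simp, fun s => (hd s).deriv⟩
  rw [contDiff_infty_iff_deriv]
  refine ⟨fun s => (hd s).differentiableAt, ?_⟩
  rw [show deriv (fun s => c + ∫ t in s₀..s, F t) = F from funext fun s => (hd s).deriv]
  exact hF

/-- All coordinates except `x_{n+1}` follow their Taylor polynomials, and `x_{n+1}` is found by
integrating the contact equation. Its value at `s₀` is chosen; its higher derivatives are forced by
the contact equations, which `w` satisfies too. -/
theorem exists_integral_curve {r : ℕ} {w : Fin (r + 1) → Coord n}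
    (hw : ∀ k < r, contactEq w k = 0) (s₀ : ℝ) :
    ∃ v : ℝ → Coord n, ContDiff ℝ ∞ v ∧ (∀ s, contactForm v s = 0) ∧ jetOf r v s₀ = w := by
  let P : ℝ → Coord n := taylorCurve w s₀
  have hP : ContDiff ℝ ∞ P := contDiff_taylorCurve_right w s₀
  have hPc : ∀ p, ContDiff ℝ ∞ fun t => P t p := fun p => contDiff_pi.1 hP p
  have hF : ContDiff ℝ ∞ fun t => -∑ j : Fin n, P t (dualIdx j) *
      deriv (fun t => P t (lineIdx j.castSucc)) t := by
    refine (ContDiff.sum fun j _ => (hPc _).mul ?_).neg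
    exact (contDiff_infty_iff_deriv.1 (hPc _)).2
  obtain ⟨G, hG, hG0, hGd⟩ := exists_antideriv hF s₀ (w 0 (lineIdx (Fin.last n)))
  let v : ℝ → Coord n := fun t => Function.update (P t) (lineIdx (Fin.last n)) (G t)
  have hvlast : ∀ t, v t (lineIdx (Fin.last n)) = G t := fun t => Function.update_self _ _ _
  have hvne : ∀ p, p ≠ lineIdx (Fin.last n) → ∀ t, v t p = P t p := fun p hp t =>
    Function.update_of_ne hp _ _
  have hline : ∀ j : Fin n, lineIdx j.castSucc ≠ lineIdx (Fin.last n) := fun j h =>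
    (Fin.castSucc_lt_last j).ne (lineIdx_injective h)
  have hdual : ∀ j : Fin n, dualIdx j ≠ lineIdx (Fin.last n) := fun j h =>
    lineIdx_ne_dualIdx _ _ h.symm
  have hv : ContDiff ℝ ∞ v := by
    rw [contDiff_pi]
    intro p
    by_cases hp : p = lineIdx (Fin.last n)
    · subst hp
      simpa only [hvlast] using hG
    · simpa only [hvne p hp] using hPc p
  have hcontact : ∀ s, contactForm v s = 0 := by
    intro s
    simp only [contactForm, hvlast, hvne _ (hline _), hvne _ (hdual _), hGd]
    ring
  have hne : ∀ (k : ℕ) (hk : k < r + 1) (p), p ≠ lineIdx (Fin.last n) →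
      jetAt (jetOf r v s₀) k p = jetAt w k p := by
    intro k hk p hp
    rw [jetAt_jetOf _ _ (by omega), ← iteratedDeriv_coord hv.contDiffAt]
    simp only [hvne p hp]
    rw [iteratedDeriv_coord hP.contDiffAt, jetAt_of_lt _ hk]
    exact congrFun (iteratedDeriv_taylorCurve w s₀ ⟨k, hk⟩) p
  refine ⟨v, hv, hcontact, ?_⟩
  suffices h : ∀ (k : ℕ) (hk : k < r + 1) (p), jetAt (jetOf r v s₀) k p = jetAt w k p by
    funext k p
    simpa [jetAt_of_lt _ k.2] using h k k.2 p
  intro k hk p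
  by_cases hp : p = lineIdx (Fin.last n)
  · subst hp
    rcases Nat.eq_zero_or_pos k with rfl | hk0
    · rw [jetAt_jetOf _ _ (by omega), iteratedDeriv_zero, hvlast, hG0, jetAt_of_lt _ hk]
      rfl
    · obtain ⟨m, rfl⟩ : ∃ m, k = m + 1 := ⟨k - 1, by omega⟩
      have h1 : contactEq (jetOf r v s₀) m = contactEq w m := by
        rw [hw m (by omega), contactEq_jetOf hv.contDiffAt (by omega),
          show contactForm v = fun _ => 0 from funext hcontact]
        simp
      unfold contactEq at h1
      have h2 : ∀ j : Fin n, ∀ i ∈ Finset.range (m + 1),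
          (m.choose i : ℝ) * jetAt (jetOf r v s₀) i (dualIdx j) *
            jetAt (jetOf r v s₀) (m - i + 1) (lineIdx j.castSucc) =
          (m.choose i : ℝ) * jetAt w i (dualIdx j) * jetAt w (m - i + 1) (lineIdx j.castSucc) := by
        intro j i hi
        rw [Finset.mem_range] at hi
        rw [hne _ (by omega) _ (hdual j), hne _ (by omega) _ (hline j)]
      rw [Finset.sum_congr rfl fun j _ => Finset.sum_congr rfl (h2 j)] at h1
      exact add_right_cancel h1
  · exact hne k hk p hp

end JetsOfCurves

/-! ### The two sets of jets in charts -/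

section ChartImages

variable {I : Type*} [TopologicalSpace I] [ChartedSpace ℝ I] {n r : ℕ}

/-- The change of coordinates of the jet space induced by `straighten`. -/
noncomputable def straightenJet (n r : ℕ) (x : JetCoord n r) : JetCoord n r :=
  (x.1, prolong r straighten x.2)

theorem IsSubmanifoldOfCodim.preimage_straightenJet {S : Set (JetCoord n r)} {m : ℕ}
    (h : IsSubmanifoldOfCodim S m) : IsSubmanifoldOfCodim (straightenJet n r ⁻¹' S) m := by
  refine h.preimage (ψ := fun x : JetCoord n r => (x.1, prolong r unstraighten x.2)) ?_ ?_ ?_ ?_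
  · exact contDiff_fst.prodMk ((contDiff_prolong r contDiff_straighten).comp contDiff_snd)
  · exact contDiff_fst.prodMk ((contDiff_prolong r contDiff_unstraighten).comp contDiff_snd)
  · intro y
    simp only [straightenJet]
    rw [prolong_prolong r contDiff_unstraighten contDiff_straighten straighten_unstraighten]
  · intro y
    simp only [straightenJet]
    rw [prolong_prolong r contDiff_straighten contDiff_unstraighten unstraighten_straighten]

theorem exists_curveAt {κ : OpenPartialHomeomorph I ℝ} (hκ : κ ∈ atlas ℝ I)
    (g : GL (Fin (n + 2)) ℝ) {v : ℝ → Coord n} (hv : ContDiff ℝ ∞ v)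
    (hcontact : ∀ s, contactForm v s = 0) {s₀ : ℝ} (hs₀ : s₀ ∈ κ.target) :
    ∃ c : CurveAt I n, c.t = κ.symm s₀ ∧ IsIntegralNear c.Γ c.t ∧
      IsLocalExpr c.Γ κ g (fun s => unstraighten (v s)) κ.target := by
  have hu : ContDiff ℝ ∞ fun s => unstraighten (v s) := contDiff_unstraighten.comp hv
  have hexpr : IsLocalExpr (fun p => chartFlag g (unstraighten (v (κ p)))) κ g
      (fun s => unstraighten (v s)) κ.target :=
    { mem_atlas := hκ
      isOpen := κ.open_target
      subset := le_rfl
      smooth := hu.contDiffOn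
      expr := fun s hs => by
        rw [κ.right_inv hs]
        exact isChartCoord_chartFlag _ _ }
  have hsrc : κ.symm s₀ ∈ κ.source := κ.map_target hs₀
  have htgt : κ (κ.symm s₀) ∈ κ.target := by rwa [κ.right_inv hs₀]
  refine ⟨⟨κ.symm s₀, _, ⟨κ, g, _, _, hexpr, hsrc, htgt⟩⟩, rfl,
    ⟨κ, g, _, _, hexpr, hsrc, htgt, fun s _ => ?_⟩, hexpr⟩
  rw [mem_pseudoContact_iff_contactForm g (hu.differentiable (by simp) s)]
  simpa only [straighten_unstraighten] using hcontact s

theorem straightenJet_eq {κ : OpenPartialHomeomorph I ℝ} {g : GL (Fin (n + 2)) ℝ} {t : I}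
    {Γ : I → CompleteFlag n} {u : ℝ → Coord n} {W : Set ℝ} (h : IsLocalExpr Γ κ g u W)
    (hm : κ t ∈ W) :
    straightenJet n r (κ t, fun k : Fin (r + 1) => iteratedDeriv (k : ℕ) u (κ t)) =
      (κ t, jetOf r (fun s => straighten (u s)) (κ t)) := by
  rw [straightenJet]
  congr 1
  exact prolong_jet r contDiff_straighten (h.smooth.contDiffAt (h.isOpen.mem_nhds hm))

theorem contactEq_eq_zero_of_isIntegralNear [IsManifold 𝓘(ℝ, ℝ) ∞ I] {Γ : I → CompleteFlag n}
    {t : I} (hΓ : IsIntegralNear Γ t) {κ : OpenPartialHomeomorph I ℝ} {g : GL (Fin (n + 2)) ℝ}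
    {u : ℝ → Coord n} {W : Set ℝ} (h : IsLocalExpr Γ κ g u W) (ht : t ∈ κ.source)
    (hm : κ t ∈ W) {k : ℕ} (hk : k < r) :
    contactEq (jetOf r (fun s => straighten (u s)) (κ t)) k = 0 := by
  have hu : ContDiffAt ℝ ∞ u (κ t) := h.smooth.contDiffAt (h.isOpen.mem_nhds hm)
  rw [contactEq_jetOf (v := fun s => straighten (u s))
    (contDiff_straighten.contDiffAt.comp _ hu) hk]
  have hev : contactForm (fun s => straighten (u s)) =ᶠ[nhds (κ t)] fun _ => 0 := by
    filter_upwards [hΓ.eventually_mem_pseudoContact h ht hm, h.isOpen.mem_nhds hm] with s hs hsW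
    exact (mem_pseudoContact_iff_contactForm g ((h.smooth.contDiffAt
      (h.isOpen.mem_nhds hsW)).differentiableAt (by simp))).1 hs
  rw [hev.iteratedDeriv_eq]
  simp

theorem exists_curveAt_of_contactEq {κ : OpenPartialHomeomorph I ℝ} (hκ : κ ∈ atlas ℝ I)
    (g : GL (Fin (n + 2)) ℝ) {x : JetCoord n r} (hx : straightenJet n r x ∈ contactSet n r κ.target) :
    ∃ c : CurveAt I n, IsIntegralNear c.Γ c.t ∧ ∃ u, IsLocalExpr c.Γ κ g u κ.target ∧
      c.t ∈ κ.source ∧ κ c.t ∈ κ.target ∧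
      x = (κ c.t, fun k : Fin (r + 1) => iteratedDeriv (k : ℕ) u (κ c.t)) := by
  obtain ⟨hx1, hx2⟩ := hx
  obtain ⟨v, hv, hcontact, hjet⟩ := exists_integral_curve hx2 x.1
  obtain ⟨c, hc, hintegral, hexpr⟩ := exists_curveAt hκ g hv hcontact hx1
  have hκc : κ c.t = x.1 := by rw [hc]; exact κ.right_inv hx1
  refine ⟨c, hintegral, _, hexpr, hc ▸ κ.map_target hx1, hκc ▸ hx1, ?_⟩
  rw [hκc, ← prolong_jet r contDiff_unstraighten hv.contDiffAt]
  change x = (x.1, prolong r unstraighten (jetOf r v x.1))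
  rw [hjet, straightenJet,
    prolong_prolong r contDiff_straighten contDiff_unstraighten unstraighten_straighten]

theorem chartImage_integralJets [IsManifold 𝓘(ℝ, ℝ) ∞ I] {κ : OpenPartialHomeomorph I ℝ}
    (hκ : κ ∈ atlas ℝ I) (g : GL (Fin (n + 2)) ℝ) :
    chartImage (integralJets I n r) κ g = straightenJet n r ⁻¹' contactSet n r κ.target := by
  ext x
  constructor
  · rintro ⟨c, ⟨c', hjet, hintegral⟩, hcoord⟩
    -- The integral representative `c'` has the same jet coordinates as `c` in this chart, so the
    -- equations can be checked on `c'`.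
    obtain ⟨u, W, h, ht, hm, rfl⟩ := ((Quotient.exact hjet).2 κ g x).2 hcoord
    rw [Set.mem_preimage, straightenJet_eq h hm]
    exact ⟨h.subset hm, fun k hk => contactEq_eq_zero_of_isIntegralNear hintegral h ht hm hk⟩
  · intro hx
    obtain ⟨c, hintegral, u, h, ht, hm, hxc⟩ := exists_curveAt_of_contactEq hκ g hx
    exact ⟨c, ⟨c, rfl, hintegral⟩, u, _, h, ht, hm, hxc⟩

theorem chartImage_typeJets [IsManifold 𝓘(ℝ, ℝ) ∞ I] {a : Fin (n + 1) → ℕ} (ha : StrictMono a)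
    (ha₁ : 1 ≤ a 0) (hr : a (Fin.last n) ≤ r) {κ : OpenPartialHomeomorph I ℝ}
    (hκ : κ ∈ atlas ℝ I) (g : GL (Fin (n + 2)) ℝ) :
    chartImage (typeJets I n r a) κ g =
      straightenJet n r ⁻¹' contactTypeSet n r κ.target a := by
  ext x
  constructor
  · rintro ⟨c, ⟨c', hjet, hintegral, htype⟩, hcoord⟩
    obtain ⟨u, W, h, ht, hm, rfl⟩ := ((Quotient.exact hjet).2 κ g x).2 hcoord
    rw [Set.mem_preimage, straightenJet_eq h hm]
    refine ⟨h.subset hm, fun k hk => contactEq_eq_zero_of_isIntegralNear hintegral h ht hm hk, ?_⟩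
    rw [projIsOfType_iff h.isLift ht hm] at htype
    exact (isOfType_lineVec_iff ha ha₁ hr g
      (h.smooth.contDiffAt (h.isOpen.mem_nhds hm))).1 htype
  · intro hx
    obtain ⟨c, hintegral, u, h, ht, hm, rfl⟩ := exists_curveAt_of_contactEq hκ g ⟨hx.1, hx.2.1⟩
    refine ⟨c, ⟨c, rfl, hintegral, ?_⟩, u, _, h, ht, hm, rfl⟩
    rw [projIsOfType_iff h.isLift ht hm]
    refine (isOfType_lineVec_iff ha ha₁ hr g
      (h.smooth.contDiffAt (h.isOpen.mem_nhds hm))).2 ?_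
    have hx' := hx
    rw [Set.mem_preimage, straightenJet_eq h hm] at hx'
    exact hx'.2.2

end ChartImages

/-! ### A monomial integral curve of given type -/

section Nonempty

variable {n : ℕ}

/-- For `x_i = (s - s₀)^{a_i} / a_i!` the derivatives of orders `0, a_1, …, a_{n+1}` at `s₀` are the
standard basis. Integrality needs only `y_1 = -x_{n+1}' / x_1'`, a monomial since `a_1 ≤ a_{n+1}`;
here `n ≥ 1` provides `y_1`. -/
theorem exists_curve_of_type (hn : 1 ≤ n) {a : Fin (n + 1) → ℕ} (ha : StrictMono a)
    (ha₁ : 1 ≤ a 0) {r : ℕ} (hr : a (Fin.last n) ≤ r) (s₀ : ℝ) :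
    ∃ v : ℝ → Coord n, ContDiff ℝ ∞ v ∧ (∀ s, contactForm v s = 0) ∧
      JetHasType (jetOf r v s₀) a := by
  have har : ∀ i, a i ≤ r := fun i => (ha.monotone (Fin.le_last i)).trans hr
  have ha0 : ∀ i, a 0 ≤ a i := fun i => ha.monotone (Fin.zero_le i)
  have hs := strictMono_cons_zero ha ha₁
  let X : Fin (n + 1) → ℝ → ℝ := fun i s => (s - s₀) ^ a i / ((a i).factorial : ℝ)
  let Y : Fin n → ℝ → ℝ := fun j s => if (j : ℕ) = 0 then
    -(((a 0 - 1).factorial : ℝ) / ((a (Fin.last n) - 1).factorial : ℝ)) *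
      (s - s₀) ^ (a (Fin.last n) - a 0) else 0
  have hX : ∀ i, ContDiff ℝ ∞ (X i) := fun i => by fun_prop
  have hY : ∀ j, ContDiff ℝ ∞ (Y j) := fun j => by
    simp only [Y]
    split_ifs
    · fun_prop
    · exact contDiff_const
  have hinj : Function.Injective (Sum.elim (lineIdx (n := n)) dualIdx) :=
    lineIdx_injective.sumElim dualIdx_injective lineIdx_ne_dualIdx
  let v : ℝ → Coord n := fun s => Function.extend (Sum.elim lineIdx dualIdx)
    (Sum.elim (fun i => X i s) (fun j => Y j s)) 0
  have hvX : ∀ s i, v s (lineIdx i) = X i s := fun s i => hinj.extend_apply _ _ (Sum.inl i)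
  have hvY : ∀ s j, v s (dualIdx j) = Y j s := fun s j => hinj.extend_apply _ _ (Sum.inr j)
  have hv : ContDiff ℝ ∞ v := by
    rw [contDiff_pi]
    intro p
    by_cases hp : ∃ q, Sum.elim (lineIdx (n := n)) dualIdx q = p
    · obtain ⟨i | j, rfl⟩ := hp
      · simpa only [Sum.elim_inl, hvX] using hX i
      · simpa only [Sum.elim_inr, hvY] using hY j
    · simp only [v, Function.extend_apply' _ _ _ hp]
      exact contDiff_const
  have hXd : ∀ i s, deriv (X i) s = (s - s₀) ^ (a i - 1) / ((a i - 1).factorial : ℝ) := by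
    intro i s
    obtain ⟨m, hm⟩ : ∃ m, a i = m + 1 := ⟨a i - 1, by have := ha0 i; omega⟩
    have h1 : HasDerivAt (X i) (((m + 1 : ℕ) : ℝ) * (s - s₀) ^ m * 1 / ((m + 1).factorial : ℝ)) s := by
      simp only [X, hm]
      exact (((hasDerivAt_id s).sub_const s₀).pow (m + 1)).div_const _
    rw [h1.deriv, hm, Nat.add_sub_cancel, Nat.factorial_succ]
    have h2 : ((m.factorial : ℕ) : ℝ) ≠ 0 := Nat.cast_ne_zero.2 (Nat.factorial_ne_zero m)
    have h3 : ((m : ℝ) + 1) ≠ 0 := by positivity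
    push_cast
    field_simp
  refine ⟨v, hv, fun s => ?_, ?_⟩
  · simp only [contactForm, hvX, hvY]
    rw [Finset.sum_eq_single (⟨0, hn⟩ : Fin n)]
    · have h0 : (⟨0, hn⟩ : Fin n).castSucc = 0 := rfl
      have hlt : a 0 ≤ a (Fin.last n) := ha0 _
      have hpow : (s - s₀) ^ (a (Fin.last n) - 1) =
          (s - s₀) ^ (a (Fin.last n) - a 0) * (s - s₀) ^ (a 0 - 1) := by
        rw [← pow_add]
        congr 1
        omega
      change deriv (X (Fin.last n)) s + Y ⟨0, hn⟩ s * deriv (X (⟨0, hn⟩ : Fin n).castSucc) s = 0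
      rw [h0, hXd, hXd, hpow]
      simp only [Y, if_true]
      have h2 : (((a 0 - 1).factorial : ℕ) : ℝ) ≠ 0 := Nat.cast_ne_zero.2 (Nat.factorial_ne_zero _)
      field_simp
      ring
    · intro j _ hj
      have : (j : ℕ) ≠ 0 := fun h => hj (Fin.ext h)
      simp only [Y, this, if_false, zero_mul]
    · simp
  · have hjet : ∀ k ≤ r, lineJet (jetOf r v s₀) k =
        (Fin.cons (if k = 0 then 1 else 0) fun i => if k = a i then 1 else 0 : Vec n) := by
      intro k hk
      simp only [lineJet]
      congr 1
      funext i
      rw [jetAt_jetOf _ _ hk, ← iteratedDeriv_coord hv.contDiffAt]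
      simp only [hvX]
      exact iteratedDeriv_monomial (a i) k s₀
    have hb : ∀ j, (Fin.cons 0 a : Fin (n + 2) → ℕ) j ≤ r := fun j =>
      Fin.cases (Nat.zero_le _) (fun i => har i) j
    have hjet' : ∀ k ≤ r, ∀ i, lineJet (jetOf r v s₀) k i =
        if k = (Fin.cons 0 a : Fin (n + 2) → ℕ) i then 1 else 0 := by
      intro k hk i
      rw [hjet k hk]
      refine Fin.cases ?_ (fun i => ?_) i <;> simp
    have hone : pickCols (lineJet (jetOf r v s₀)) (Fin.cons 0 a) = 1 := by
      ext i j
      simp only [pickCols, Matrix.of_apply, hjet' _ (hb j), hs.injective.eq_iff,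
        Matrix.one_apply, eq_comm]
    refine ⟨by rw [hone]; simp, fun j c hc => ?_⟩
    rw [hone, Matrix.cramer_one, Module.End.one_apply, hjet' c (hc.le.trans (hb j)), if_neg hc.ne]

theorem typeJets_nonempty {I : Type*} [TopologicalSpace I] [ChartedSpace ℝ I]
    [IsManifold 𝓘(ℝ, ℝ) ∞ I] [Nonempty I] (hn : 1 ≤ n) {a : Fin (n + 1) → ℕ} (ha : StrictMono a)
    (ha₁ : 1 ≤ a 0) {r : ℕ} (hr : a (Fin.last n) ≤ r) : (typeJets I n r a).Nonempty := by
  obtain ⟨t⟩ := ‹Nonempty I›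
  let κ := chartAt ℝ t
  have hs₀ : κ t ∈ κ.target := mem_chart_target ℝ t
  obtain ⟨v, hv, hcontact, htype⟩ := exists_curve_of_type hn ha ha₁ hr (κ t)
  obtain ⟨c, hc, hintegral, hexpr⟩ := exists_curveAt (chart_mem_atlas ℝ t) 1 hv hcontact hs₀
  have hct : c.t = t := hc.trans (κ.left_inv (mem_chart_source ℝ t))
  refine ⟨c.jet r, c, rfl, hintegral, ?_⟩
  rw [hct, projIsOfType_iff hexpr.isLift (mem_chart_source ℝ t) hs₀,
    isOfType_lineVec_iff (r := r) ha ha₁ hr 1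
      (u := fun s => unstraighten (v s)) (contDiff_unstraighten.comp hv).contDiffAt]
  simpa only [straighten_unstraighten] using htype

end Nonempty

end FlagJet

theorem mainTheorem2 {I : Type*} [TopologicalSpace I] [ChartedSpace ℝ I]
    [IsManifold 𝓘(ℝ, ℝ) ∞ I] [Nonempty I]
    (n : ℕ) (hn : 1 ≤ n) (a : Fin (n + 1) → ℕ) (ha : StrictMono a) (ha₁ : 1 ≤ a 0)
    (r : ℕ) (hr : a (Fin.last n) ≤ r) :
    (FlagJet.typeJets I n r a).Nonempty ∧
    FlagJet.HasCodimIn (FlagJet.typeJets I n r a) (FlagJet.integralJets I n r)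
      (∑ i : Fin n, ((a i.succ : ℤ) - ((i : ℕ) + 2 : ℤ))) ∧
    (∑ i : Fin n, ((a i.succ : ℤ) - ((i : ℕ) + 2 : ℤ))) =
      FlagJet.schubertNumber a - ((a 0 : ℤ) - 1) := by
  refine ⟨FlagJet.typeJets_nonempty hn ha ha₁ hr, ⟨?_, r,
    r + Fintype.card (FlagJet.TypeEqIdx r a), fun κ hκ g => ?_, fun κ hκ g => ?_, ?_⟩, ?_⟩
  · rintro j ⟨c, hj, hintegral, -⟩
    exact ⟨c, hj, hintegral⟩
  · rw [FlagJet.chartImage_integralJets hκ g]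
    exact (FlagJet.isSubmanifoldOfCodim_contactSet κ.open_target).preimage_straightenJet
  · rw [FlagJet.chartImage_typeJets ha ha₁ hr hκ g]
    exact (FlagJet.isSubmanifoldOfCodim_contactTypeSet κ.open_target ha ha₁
      hr).preimage_straightenJet
  · rw [← FlagJet.card_typeEqIdx ha ha₁ hr]
    push_cast
    ring
  · rw [FlagJet.schubertNumber, Fin.sum_univ_succ, Fin.val_zero, Nat.cast_zero, zero_add,
      add_sub_cancel_left]
    refine Finset.sum_congr rfl fun i _ => ?_
    rw [Fin.val_succ]
    push_cast
    ring
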